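/- Let $\ell$ and $p$ be distinct primes and let $T_d$ denote the monic Chebyshev polynomial, $T_d(z+z^{-1})=z^d+z^{-d}$; write $T_\ell^n$ for the $n$-fold iterate of $T_\ell$. Let $t\in\mathbb Z$ be such that $T_\ell^n(x)-t$ is irreducible over $\mathbb Z$ for every $n\ge 1$. Choose elements $\theta_0=t,\theta_1,\theta_2,\dots$ of a field of characteristic $0$ with $T_\ell(\theta_{n+1})=\theta_n$, and put $K_n=\mathbb Q(\theta_n)$ and $K_\infty=\bigcup_n K_n$ (so $K_0=\mathbb Q$). Let $\mu$ be the order of $p$ in $(\mathbb Z/\ell\mathbb Z)^\times/(\pm1)$, let $D_1$ and $D_2$ be the elements of $\{p^\mu-1,p^\mu+1\}$ with the larger and the smaller $\ell$-adic valuation respectively, and let $v=\nu_\ell(D_1)$. Let $\bar t\in\mathbb F_p$ be the reduction of $t$ and let $\rho\ge 0$ be its preperiod under $T_\ell:\mathbb F_p\to\mathbb F_p$, i.e. the least $\rho$ such that $T_\ell^{\rho+\pi}(\bar t)=T_\ell^{\rho}(\bar t)$ for some $\pi\ge1$. An element $a\in\mathbb F_p$ corresponds to the integer $d$ if $a=\alpha+\alpha^{-1}$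 with $\alpha\in\mathbb F_{p^2}^\times$ of order $d$; all elements of a cycle of $T_\ell$ on $\mathbb F_p$ correspond to the same $d$, and $\bar t$ is connected to that cycle if its forward orbit under $T_\ell$ enters it. Suppose $p\nmid \ell(4-t^2)$. **Case 1: $\ell$ is odd.** 1. If $\rho>0$, then $\rho\le v$, $p$ splits completely in $K_1,\dots,K_{v-\rho}$, and $p$ is totally inert afterwards: every prime of $K_{v-\rho}$ above $p$ remains prime in $K_n$ for all $n\ge v-\rho$. 2. If $\rho=0$, then for every $n$ there is at least one prime of $K_n$ above $p$ of degree $1$, and there is exactly one prime of $K_\infty$ above $p$ of degree $1$ (that is, with residue field $\mathbb F_p$). **Case 2: $\ell=2$.** 1. If $\rho>0$ and $\bar t$ is connected to a cycle corresponding to a divisor $d$ of $D_1$, then $\rho\le v$, $p$ splits completely in $K_1,\dots,K_{v-\rho}$, and every prime of $K_{v-\rho}$ above $p$ remains prime in $K_n$ for all $n\ge v-\rho$. 2. If $\rho>0$ and $\bar t$ is connected to a cycle corresponding to a divisor $d\ne1$ of $D_2$, then $\rho\le v$, $p$ is inert in $K_1$, the prime of $K_1$ above $p$ splits completely in $K_2,\dots,K_{v-\rho+1}$,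 and every prime of $K_{v-\rho+1}$ above $p$ remains prime in $K_n$ for all $n\ge v-\rho+1$. 3. If $\rho=0$, then for every $n$ there is at least one prime of $K_n$ above $p$ of degree $1$, and there is exactly one prime of $K_\infty$ above $p$ of degree $1$. -/

import Mathlib

open NumberField

noncomputable section

namespace ChebTower

/-- The monic Chebyshev polynomial `T_d`, with `T_d (z + z⁻¹) = z ^ d + (z⁻¹) ^ d`. -/
def chebPoly (d : ℕ) (R : Type*) [CommRing R] : Polynomial R :=
  Polynomial.Chebyshev.C R (d : ℤ)

/-- The `n`-th iterate of `T_d` under composition, as a polynomial; the `0`-th iterate is `x`. -/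
def chebIter (d : ℕ) (R : Type*) [CommRing R] (n : ℕ) : Polynomial R :=
  (chebPoly d R).comp^[n] Polynomial.X

/-- The self-map `a ↦ T_d(a)` of a commutative ring. -/
def chebMap (d : ℕ) (R : Type*) [CommRing R] (a : R) : R :=
  (chebPoly d R).eval a

/-- The preperiod of `a` under `φ`: the least `ρ` with `φ^{ρ+π}(a) = φ^ρ(a)` for some `π ≥ 1`.
Such a `ρ` always exists on a finite set. -/
def preperiod {S : Type*} (φ : S → S) (a : S) : ℕ :=
  sInf {r : ℕ | ∃ π : ℕ, 1 ≤ π ∧ φ^[r + π] a = φ^[r] a}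

/-- The order of `p` in `(ℤ/ℓℤ)ˣ / (±1)`. -/
def mu (ℓ p : ℕ) (h : p.Coprime ℓ) : ℕ :=
  orderOf (QuotientGroup.mk (ZMod.unitOfCoprime p h) :
    (ZMod ℓ)ˣ ⧸ Subgroup.zpowers (-1 : (ZMod ℓ)ˣ))

/-- The one of `p ^ μ - 1`, `p ^ μ + 1` with the larger `ℓ`-adic valuation. -/
def D₁ (ℓ p : ℕ) (h : p.Coprime ℓ) : ℕ :=
  if padicValNat ℓ (p ^ mu ℓ p h - 1) < padicValNat ℓ (p ^ mu ℓ p h + 1)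
  then p ^ mu ℓ p h + 1 else p ^ mu ℓ p h - 1

/-- The one of `p ^ μ - 1`, `p ^ μ + 1` with the smaller `ℓ`-adic valuation. -/
def D₂ (ℓ p : ℕ) (h : p.Coprime ℓ) : ℕ :=
  if padicValNat ℓ (p ^ mu ℓ p h - 1) < padicValNat ℓ (p ^ mu ℓ p h + 1)
  then p ^ mu ℓ p h - 1 else p ^ mu ℓ p h + 1

/-- The element `a` of `𝔽_p` corresponds to the number `d`: one has `a = α + α⁻¹` for some
`α ∈ 𝔽_{p²}ˣ` of order `d`. -/
def CorrespondsTo (p : ℕ) [Fact p.Prime] (a : ZMod p) (d : ℕ) : Prop :=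
  ∃ α : (GaloisField p 2)ˣ,
    algebraMap (ZMod p) (GaloisField p 2) a = (α : GaloisField p 2) + (α⁻¹ : (GaloisField p 2)ˣ) ∧
      orderOf α = d

/-- In the graph of `T_ℓ` over `𝔽_p`, the vertex `a` is connected to a cycle whose vertices
correspond to the number `d`: the orbit of `a` runs into a periodic point corresponding to `d`. -/
def ConnectedToCycle (ℓ p : ℕ) [Fact p.Prime] (a : ZMod p) (d : ℕ) : Prop :=
  ∃ k : ℕ, (chebMap ℓ (ZMod p))^[k] a ∈ Function.periodicPts (chebMap ℓ (ZMod p)) ∧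
    CorrespondsTo p ((chebMap ℓ (ZMod p))^[k] a) d

section Fields

variable {L : Type*} [Field L] [CharZero L]

/-- `θ` is a compatible sequence of preimages of `t`: `θ 0 = t` and `T_ℓ (θ (n+1)) = θ n`. -/
def IsCompatible (ℓ : ℕ) (t : ℤ) (θ : ℕ → L) : Prop :=
  θ 0 = (t : L) ∧ ∀ n : ℕ, chebMap ℓ L (θ (n + 1)) = θ n

/-- The field `K_n = ℚ(θ_n)`. -/
def level (θ : ℕ → L) (n : ℕ) : IntermediateField ℚ L :=
  IntermediateField.adjoin ℚ {θ n}

/-- The infinite level `K_∞`, the compositum (union) of all the `K_n`. -/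
def levelInfty (θ : ℕ → L) : IntermediateField ℚ L :=
  ⨆ n, level θ n

/-- The ideal `J` is a product of exactly `k` pairwise distinct prime ideals. -/
def IsProdDistinctPrimes {R : Type*} [CommRing R] (J : Ideal R) (k : ℕ) : Prop :=
  ∃ S : Finset (Ideal R), S.card = k ∧ (∀ P ∈ S, P.IsPrime) ∧ J = ∏ P ∈ S, P

/-- `p` splits completely in `F`: `p 𝓞_F` is a product of `[F : ℚ]` distinct primes. -/
def SplitsCompletely (p : ℕ) (F : IntermediateField ℚ L) : Prop :=
  IsProdDistinctPrimes (Ideal.span {(p : 𝓞 F)}) (Module.finrank ℚ F)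

/-- `p` is inert in `F`: `p 𝓞_F` is a prime ideal. -/
def Inert (p : ℕ) (F : IntermediateField ℚ L) : Prop :=
  (Ideal.span {(p : 𝓞 F)}).IsPrime

/-- The inclusion of the rings of integers of `E ≤ F`. -/
def ringInclusion {E F : IntermediateField ℚ L} (h : E ≤ F) : 𝓞 E →+* 𝓞 F :=
  RingOfIntegers.mapRingHom (IntermediateField.inclusion h).toRingHom

/-- `F / E` is an extension in which every prime of `E` above `p` splits completely. -/
def SplitsCompletelyAbove (p : ℕ) (E F : IntermediateField ℚ L) : Prop :=
  ∃ h : E ≤ F, ∀ P : Ideal (𝓞 E), P.IsPrime → (p : 𝓞 E) ∈ P →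
    IsProdDistinctPrimes (P.map (ringInclusion h)) (IntermediateField.relfinrank E F)

/-- `F / E` is an extension in which every prime of `E` above `p` stays prime. -/
def InertAbove (p : ℕ) (E F : IntermediateField ℚ L) : Prop :=
  ∃ h : E ≤ F, ∀ P : Ideal (𝓞 E), P.IsPrime → (p : 𝓞 E) ∈ P →
    (P.map (ringInclusion h)).IsPrime

/-- `P` is a prime of `F` above `p` of (residue) degree `1`. -/
def IsDegreeOnePrime (p : ℕ) (F : IntermediateField ℚ L) (P : Ideal (𝓞 F)) : Prop :=
  P.IsPrime ∧ P.LiesOver (Ideal.span {(p : ℤ)}) ∧ P.inertiaDeg ℤ = 1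

end Fields

end ChebTower

end

/-! Write `N = ℓ ^ n` and let `f = T_N - t` be the minimal polynomial of `θ n`. The identity `(X² -
4) T_N'² = N² (T_N² - 4)` shows that `f'(θ n)` divides `N² (t² - 4)`, an integer prime to `p`. Since
`f'(θ n)` lies in the conductor of `ℤ[θ n]`, the order `ℤ[θ n]` is maximal at `p`. Hence
homomorphisms from `𝓞 K_n` to an algebraic closure of `𝔽_p` are the same as points `b` with `T_N(b)
= t`. Every prime above `p` is the kernel of one, and splitting or inertia is read off from the
action of Frobenius on these points.

Write `t = α + α⁻¹` over the closure and `orderOf α = ℓ ^ j * d` with `ℓ ∤ d`. Then `j` is the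
preperiod `ρ` (`preperiod_eq`), and `d` is the number attached to the cycle
(`eq_of_connectedToCycle`). The points over `t` are `γ + γ⁻¹` with `γ ^ N = α`. If `ρ > 0`, all such
`γ` have the same order `ℓ ^ (n + ρ) * d` (`orderOf_eq_of_pow_eq`). Such a point is fixed by the `p
^ r`-power map exactly when `orderOf γ` divides `p ^ r - 1` or `p ^ r + 1`. Lifting the exponent
(`not_pow_dvd_pow_sub`) then shows that orbits are trivial up to a certain level and of maximal size
beyond it. For `ℓ = 2` and `α` on the `D₂` side, a first quadratic step precedes this, and the same
argument runs over `𝔽_{p²}`.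

If `ρ = 0`, degree one primes of `K_∞` correspond to backward orbits of `t` inside `𝔽_p`. There is
exactly one, because `T_ℓ` permutes its periodic points. -/

namespace ChebTower

open Polynomial

/-! ### Chebyshev polynomials: degree, derivative, and the substitution `z + z⁻¹`. -/

section Chebyshev

variable (R : Type*) [CommRing R]

theorem chebIter_eq (d n : ℕ) : chebIter d R n = Chebyshev.C R ((d ^ n : ℕ) : ℤ) := by
  induction n with
  | zero => simp [chebIter]
  | succ n ih =>
    rw [chebIter, Function.iterate_succ_apply', ← chebIter, ih, chebPoly, ← Chebyshev.C_mul]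
    congr 1
    push_cast
    ring

variable {R}

theorem chebMap_iterate (d n : ℕ) (a : R) :
    (chebMap d R)^[n] a = (Chebyshev.C R ((d ^ n : ℕ) : ℤ)).eval a := by
  induction n with
  | zero => simp
  | succ n ih =>
    rw [Function.iterate_succ_apply', ih, chebMap, chebPoly, ← eval_comp, ← Chebyshev.C_mul]
    congr 2
    push_cast
    ring

/-- The index is shifted by one because `T_0 = 2` need not be monic. -/
theorem chebyshev_monic_and_natDegree [Nontrivial R] (n : ℕ) :
    (Chebyshev.C R ((n + 1 : ℕ) : ℤ)).Monic ∧
      (Chebyshev.C R ((n + 1 : ℕ) : ℤ)).natDegree = n + 1 := by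
  induction n using Nat.twoStepInduction with
  | zero => simp [monic_X]
  | one =>
    have h : Chebyshev.C R ((1 + 1 : ℕ) : ℤ) = X ^ 2 - Polynomial.C 2 := by
      rw [show Polynomial.C (2 : R) = (2 : R[X]) from rfl, ← Chebyshev.C_two]
      rfl
    rw [h]
    exact ⟨monic_X_pow_sub_C _ two_ne_zero, natDegree_X_pow_sub_C⟩
  | more n ih₁ ih₂ =>
    have h : Chebyshev.C R ((n + 2 + 1 : ℕ) : ℤ) =
        X * Chebyshev.C R ((n + 1 + 1 : ℕ) : ℤ) - Chebyshev.C R ((n + 1 : ℕ) : ℤ) := by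
      have := Chebyshev.C_add_two R (n + 1 : ℤ)
      push_cast
      rwa [show (n : ℤ) + 2 + 1 = n + 1 + 2 by ring]
    have hX : (X * Chebyshev.C R ((n + 1 + 1 : ℕ) : ℤ)).Monic := monic_X.mul ih₂.1
    have hXd : (X * Chebyshev.C R ((n + 1 + 1 : ℕ) : ℤ)).natDegree = n + 3 := by
      rw [monic_X.natDegree_mul ih₂.1, natDegree_X, ih₂.2]
      ring
    have hlt : (Chebyshev.C R ((n + 1 : ℕ) : ℤ)).natDegree <
        (X * Chebyshev.C R ((n + 1 + 1 : ℕ) : ℤ)).natDegree := by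
      rw [hXd, ih₁.2]; omega
    have hlt' := degree_lt_degree hlt
    rw [h]
    exact ⟨hX.sub_of_left hlt', by rw [natDegree_sub_eq_left_of_natDegree_lt hlt, hXd]⟩

theorem chebyshev_monic [Nontrivial R] {n : ℕ} (hn : 0 < n) :
    (Chebyshev.C R (n : ℤ)).Monic := by
  obtain ⟨m, rfl⟩ := Nat.exists_eq_add_of_lt hn
  simpa [add_comm] using (chebyshev_monic_and_natDegree (R := R) m).1

theorem chebyshev_natDegree [Nontrivial R] {n : ℕ} (hn : 0 < n) :
    (Chebyshev.C R (n : ℤ)).natDegree = n := by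
  obtain ⟨m, rfl⟩ := Nat.exists_eq_add_of_lt hn
  simpa [add_comm] using (chebyshev_monic_and_natDegree (R := R) m).2

theorem chebyshev_sub_C_monic [Nontrivial R] {n : ℕ} (hn : 0 < n) (a : R) :
    (Chebyshev.C R (n : ℤ) - Polynomial.C a).Monic := by
  refine (chebyshev_monic hn).sub_of_left (degree_lt_degree ?_)
  rw [natDegree_C, chebyshev_natDegree hn]
  exact hn

theorem chebyshev_sub_C_natDegree [Nontrivial R] {n : ℕ} (hn : 0 < n) (a : R) :
    (Chebyshev.C R (n : ℤ) - Polynomial.C a).natDegree = n := by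
  rw [natDegree_sub_C, chebyshev_natDegree hn]

variable (R) in
theorem derivative_chebyshev (n : ℕ) :
    derivative (Chebyshev.C R (n : ℤ)) = n * Chebyshev.S R ((n : ℤ) - 1) := by
  induction n using Nat.twoStepInduction with
  | zero => simp
  | one => simp
  | more n ih₁ ih₂ =>
    have h1 := Chebyshev.C_add_two R (n : ℤ)
    have h2 := Chebyshev.S_eq_X_mul_S_add_C R (n : ℤ)
    have h3 := Chebyshev.S_add_one R (n : ℤ)
    push_cast at ih₁ ih₂ ⊢
    rw [h1, derivative_sub, derivative_mul, derivative_X, ih₁, ih₂]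
    rw [show (n : ℤ) + 2 - 1 = n + 1 by ring, show (n : ℤ) + 1 - 1 = n by ring]
    linear_combination (-1 : R[X]) * h2 - (n : R[X]) * h3

/-- This is the Pell relation `T_n² - 4 = (X² - 4) S_{n-1}²` combined with `T_n' = n S_{n-1}`. It
controls both the conductor in characteristic `0` and separability in characteristic `p`. -/
theorem X_sq_sub_four_mul_derivative_chebyshev_sq (n : ℕ) :
    ((X : R[X]) ^ 2 - 4) * derivative (Chebyshev.C R (n : ℤ)) ^ 2 =
      (n : R[X]) ^ 2 * (Chebyshev.C R (n : ℤ) ^ 2 - 4) := by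
  have h1 := Chebyshev.C_eq_S_sub_X_mul_S R (n : ℤ)
  have h2 := Chebyshev.S_sq_add_S_sq R ((n : ℤ) - 1)
  rw [sub_add_cancel] at h2
  rw [derivative_chebyshev, h1]
  linear_combination (-4 : R[X]) * n ^ 2 * h2

theorem chebyshev_eval_add_inv {F : Type*} [Field F] {z : F} (hz : z ≠ 0) (n : ℕ) :
    (Chebyshev.C F (n : ℤ)).eval (z + z⁻¹) = z ^ n + (z ^ n)⁻¹ := by
  induction n using Nat.twoStepInduction with
  | zero => norm_num
  | one => simp
  | more n ih₁ ih₂ =>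
    have h1 := Chebyshev.C_add_two F (n : ℤ)
    push_cast at ih₁ ih₂ ⊢
    rw [h1, eval_sub, eval_mul, eval_X, ih₁, ih₂]
    field_simp
    ring

end Chebyshev

theorem add_inv_eq_add_inv_iff {F : Type*} [Field F] {x y : F} (hx : x ≠ 0) (hy : y ≠ 0) :
    x + x⁻¹ = y + y⁻¹ ↔ x = y ∨ x = y⁻¹ := by
  have key : (x + x⁻¹ - (y + y⁻¹)) * x = (x - y) * (x - y⁻¹) := by
    field_simp
    ring
  rw [← sub_eq_zero, ← mul_eq_zero_iff_right hx, key, mul_eq_zero, sub_eq_zero, sub_eq_zero]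

theorem exists_add_inv_eq {F : Type*} [Field F] [IsAlgClosed F] (a : F) :
    ∃ z : F, z ≠ 0 ∧ z + z⁻¹ = a := by
  obtain ⟨z, hz⟩ := IsAlgClosed.exists_root (X ^ 2 - Polynomial.C a * X + 1 : F[X]) (by
    rw [show (X ^ 2 - Polynomial.C a * X + 1 : F[X]) =
      Polynomial.C 1 * X ^ 2 + Polynomial.C (-a) * X + Polynomial.C 1 by simp; ring,
      degree_quadratic one_ne_zero]
    norm_num)
  have hz' : z ^ 2 - a * z + 1 = 0 := by simpa using hz
  have h0 : z ≠ 0 := by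
    rintro rfl
    simp at hz'
  refine ⟨z, h0, ?_⟩
  field_simp
  linear_combination hz'

/-- Every element of `A` becomes, after multiplication by an integer prime to `p`, a polynomial
with integer coefficients in one of the `θ n`. -/
def IsGeneratedPrimeTo (p : ℕ) {A : Type*} [CommRing A] (θ : ℕ → A) : Prop :=
  ∀ x : A, ∃ (n : ℕ) (c : ℤ) (h : ℤ[X]), ¬ (p : ℤ) ∣ c ∧ (c : A) * x = aeval (θ n) h

/-! ### Homomorphisms out of rings generated up to integers prime to `p`. -/

section Generated

variable {p : ℕ} {A κ : Type*} [CommRing A] [Field κ] [CharP κ p] {θ : ℕ → A}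

theorem map_aeval_int {B : Type*} [CommRing B] (φ : A →+* B) (x : A) (h : ℤ[X]) :
    φ (aeval x h) = aeval (φ x) h := by
  simpa using (aeval_algHom_apply φ.toIntAlgHom x h).symm

theorem IsGeneratedPrimeTo.ringHom_ext (hA : IsGeneratedPrimeTo p θ) {φ ψ : A →+* κ}
    (h : ∀ n, φ (θ n) = ψ (θ n)) : φ = ψ := by
  ext x
  obtain ⟨n, c, f, hc, hx⟩ := hA x
  have hc' : (c : κ) ≠ 0 := by rwa [Ne, CharP.intCast_eq_zero_iff κ p]
  have h1 := congrArg φ hx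
  have h2 := congrArg ψ hx
  rw [map_mul, map_intCast, map_aeval_int] at h1 h2
  rw [← h n, ← h1] at h2
  exact (mul_left_cancel₀ hc' h2).symm

/-- The map sends `x` to `c⁻¹ h(b n)` whenever `c x = h(θ n)`. It is well defined because integer
relations of `θ n` also hold at `b n`. Substituting `T n` raises the level, so any two
representations can be compared at a common one. -/
theorem IsGeneratedPrimeTo.exists_ringHom (hA : IsGeneratedPrimeTo p θ) (b : ℕ → κ)
    (T : ℕ → ℤ[X]) (hθ : ∀ n, aeval (θ (n + 1)) (T n) = θ n)
    (hb : ∀ n, aeval (b (n + 1)) (T n) = b n)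
    (hzero : ∀ (n : ℕ) (h : ℤ[X]), aeval (θ n) h = 0 → aeval (b n) h = 0) :
    ∃ φ : A →+* κ, ∀ n, φ (θ n) = b n := by
  let rel : ℕ → A → κ → Prop := fun n x y ↦ ∃ (c : ℤ) (h : ℤ[X]),
    (c : κ) ≠ 0 ∧ (c : A) * x = aeval (θ n) h ∧ (c : κ) * y = aeval (b n) h
  have step : ∀ n x y, rel n x y → rel (n + 1) x y := by
    rintro n x y ⟨c, h, hc, hx, hy⟩
    refine ⟨c, h.comp (T n), hc, ?_, ?_⟩
    · rw [aeval_comp, hθ, hx]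
    · rw [aeval_comp, hb, hy]
  have lift : ∀ n m, n ≤ m → ∀ x y, rel n x y → rel m x y := by
    intro n m hnm x y
    induction m, hnm using Nat.le_induction with
    | base => exact id
    | succ m _ ih => exact fun hr ↦ step m x y (ih hr)
  have uniq : ∀ n x y y', rel n x y → rel n x y' → y = y' := by
    rintro n x y y' ⟨c, h, hc, hx, hy⟩ ⟨c', h', hc', hx', hy'⟩
    have h0 : aeval (θ n) (Polynomial.C c' * h - Polynomial.C c * h') = 0 := by
      simp only [map_sub, map_mul, eq_intCast, map_intCast, ← hx, ← hx']
      ring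
    have h1 := hzero n _ h0
    simp only [map_sub, map_mul, eq_intCast, map_intCast, ← hy, ← hy'] at h1
    have h2 : (c : κ) * c' * (y - y') = 0 := by linear_combination h1
    simpa [hc, hc', sub_eq_zero] using h2
  have total : ∀ x, ∃ y n, rel n x y := by
    intro x
    obtain ⟨n, c, h, hc, hx⟩ := hA x
    have hc' : (c : κ) ≠ 0 := by rwa [Ne, CharP.intCast_eq_zero_iff κ p]
    exact ⟨(c : κ)⁻¹ * aeval (b n) h, n, c, h, hc', hx, mul_inv_cancel_left₀ hc' _⟩
  have uniq' : ∀ x y y' n n', rel n x y → rel n' x y' → y = y' := fun x y y' n n' hr hr' ↦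
    uniq (max n n') x y y' (lift _ _ (le_max_left _ _) _ _ hr)
      (lift _ _ (le_max_right _ _) _ _ hr')
  choose f N hf using total
  refine ⟨{ toFun := f, map_one' := ?_, map_mul' := ?_, map_zero' := ?_, map_add' := ?_ }, ?_⟩
  · exact uniq' 1 _ _ (N 1) 0 (hf 1) ⟨1, 1, by simp⟩
  · intro x y
    obtain ⟨c, h, hc, hx, hx'⟩ := lift _ _ (le_max_left (N x) (N y)) _ _ (hf x)
    obtain ⟨c', h', hc', hy, hy'⟩ := lift _ _ (le_max_right (N x) (N y)) _ _ (hf y)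
    refine uniq' (x * y) _ _ (N (x * y)) (max (N x) (N y)) (hf _)
      ⟨c * c', h * h', by simp [hc, hc'], ?_, ?_⟩
    · rw [map_mul, ← hx, ← hy]; push_cast; ring
    · rw [map_mul, ← hx', ← hy']; push_cast; ring
  · exact uniq' 0 _ _ (N 0) 0 (hf 0) ⟨1, 0, by simp⟩
  · intro x y
    obtain ⟨c, h, hc, hx, hx'⟩ := lift _ _ (le_max_left (N x) (N y)) _ _ (hf x)
    obtain ⟨c', h', hc', hy, hy'⟩ := lift _ _ (le_max_right (N x) (N y)) _ _ (hf y)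
    refine uniq' (x + y) _ _ (N (x + y)) (max (N x) (N y)) (hf _)
      ⟨c * c', Polynomial.C c' * h + Polynomial.C c * h', by simp [hc, hc'], ?_, ?_⟩
    · simp only [map_add, map_mul, eq_intCast, map_intCast, ← hx, ← hy]
      push_cast; ring
    · simp only [map_add, map_mul, eq_intCast, map_intCast, ← hx', ← hy']
      push_cast; ring
  · intro n
    exact uniq' (θ n) _ _ (N (θ n)) n (hf _) ⟨1, X, by simp⟩

end Generated

/-! ### Extending the kernel of a homomorphism along a monogenic extension. -/

section Extension

variable {R A κ : Type*} [CommRing R] [CommRing A] [Field κ] {ι : R →+* A} {φ : R →+* κ}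
  {θ : A} {g : R[X]}

theorem eval₂_mem_map_ker {h : R[X]} (hh : h.map φ = 0) :
    h.eval₂ ι θ ∈ (RingHom.ker φ).map ι := by
  rw [eval₂_eq_sum_range]
  refine Ideal.sum_mem _ fun i _ ↦ Ideal.mul_mem_right _ _ (Ideal.mem_map_of_mem _ ?_)
  rw [RingHom.mem_ker, ← coeff_map, hh, coeff_zero]

theorem exists_degree_lt_of_generated (hg : g.Monic) (hgθ : g.eval₂ ι θ = 0)
    (H : ∀ a, ∃ h : R[X], a - h.eval₂ ι θ ∈ (RingHom.ker φ).map ι) (a : A) :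
    ∃ h : R[X], h.degree < g.degree ∧ a - h.eval₂ ι θ ∈ (RingHom.ker φ).map ι := by
  have : Nontrivial R := φ.domain_nontrivial
  obtain ⟨h, hh⟩ := H a
  refine ⟨h %ₘ g, degree_modByMonic_lt h hg, ?_⟩
  rwa [eval₂_modByMonic_eq_self_of_root hgθ]

theorem map_ker_le_ker {ψ : A →+* κ} (hψ : ψ.comp ι = φ) :
    (RingHom.ker φ).map ι ≤ RingHom.ker ψ := by
  rw [Ideal.map_le_iff_le_comap]
  intro r hr
  rw [Ideal.mem_comap, RingHom.mem_ker, ← RingHom.comp_apply, hψ]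
  exact hr

theorem eval_map_eq_of_sub_mem {ψ : A →+* κ} (hψ : ψ.comp ι = φ) {a : A} {h : R[X]}
    (hh : a - h.eval₂ ι θ ∈ (RingHom.ker φ).map ι) : (h.map φ).eval (ψ θ) = ψ a := by
  have h1 := map_ker_le_ker hψ hh
  rw [RingHom.mem_ker, map_sub, sub_eq_zero, hom_eval₂, hψ] at h1
  rw [h1, eval_map]

/-- Modulo the extended ideal every element is a polynomial in `θ` of degree below that of `g`. If
it lies in the kernel of `ψ`, its reduction vanishes at `ψ θ`, so `hdeg` makes that reduction zero.
-/
theorem map_ker_eq_ker (hg : g.Monic) (hgθ : g.eval₂ ι θ = 0)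
    (H : ∀ a, ∃ h : R[X], a - h.eval₂ ι θ ∈ (RingHom.ker φ).map ι)
    {ψ : A →+* κ} (hψ : ψ.comp ι = φ)
    (hdeg : ∀ h : R[X], h.degree < g.degree → (h.map φ).eval (ψ θ) = 0 → h.map φ = 0) :
    (RingHom.ker φ).map ι = RingHom.ker ψ := by
  refine le_antisymm (map_ker_le_ker hψ) fun a ha ↦ ?_
  obtain ⟨h, hlt, hh⟩ := exists_degree_lt_of_generated hg hgθ H a
  have h0 : h.map φ = 0 := hdeg h hlt (by rw [eval_map_eq_of_sub_mem hψ hh]; exact ha)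
  simpa using Ideal.add_mem _ hh (eval₂_mem_map_ker (ι := ι) (θ := θ) h0)

/-- The kernels at distinct rational roots are pairwise comaximal, so their product is their
intersection. An element of the intersection reduces to a polynomial with more roots than its degree
allows. -/
theorem isProdDistinctPrimes_map_ker (hg : g.Monic) (hgθ : g.eval₂ ι θ = 0)
    (H : ∀ a, ∃ h : R[X], a - h.eval₂ ι θ ∈ (RingHom.ker φ).map ι)
    (hpos : 0 < g.natDegree) (hφ : ∀ r, φ r ≠ 0 → ∃ s, φ (s * r) = 1)
    (S : Finset κ) (hS : S.card = g.natDegree) (hrange : ∀ b ∈ S, b ∈ φ.range)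
    (hlift : ∀ b ∈ S, ∃ ψ : A →+* κ, ψ.comp ι = φ ∧ ψ θ = b) :
    IsProdDistinctPrimes ((RingHom.ker φ).map ι) g.natDegree := by
  classical
  have : Nontrivial R := φ.domain_nontrivial
  have : Nonempty (A →+* κ) := by
    obtain ⟨b, hb⟩ := Finset.card_pos.mp (hS ▸ hpos)
    exact ⟨(hlift b hb).choose⟩
  choose! Ψ hΨ hΨθ using hlift
  have hcop : ∀ b ∈ S, ∀ b' ∈ S, b ≠ b' →
      IsCoprime (RingHom.ker (Ψ b)) (RingHom.ker (Ψ b')) := by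
    intro b hb b' hb' hne
    obtain ⟨z, hz⟩ := hrange b hb
    obtain ⟨z', hz'⟩ := hrange b' hb'
    obtain ⟨s, hs⟩ := hφ (z - z') (by rwa [map_sub, hz, hz', sub_ne_zero])
    have key : ∀ r, Ψ b (ι r) = φ r := fun r ↦ by rw [← hΨ b hb]; rfl
    have key' : ∀ r, Ψ b' (ι r) = φ r := fun r ↦ by rw [← hΨ b' hb']; rfl
    rw [Ideal.isCoprime_iff_exists]
    -- The elements `s (z - θ)` and `s (θ - z')` sum to `s (z - z')`, which is `1` only modulo the
    -- kernel of `φ`. The extra summand makes up the difference.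
    refine ⟨ι s * (ι z - θ) + (1 - ι (s * (z - z'))), ?_, ι s * (θ - ι z'), ?_, ?_⟩
    · rw [RingHom.mem_ker, map_add, map_mul, map_sub, map_sub, key, key, key, hs, hΨθ b hb, hz]
      simp
    · rw [RingHom.mem_ker, map_mul, map_sub, key', hΨθ b' hb', key', hz']
      simp
    · rw [map_mul, map_sub]
      ring
  have hprime : ∀ b, (RingHom.ker (Ψ b)).IsPrime := fun b ↦ RingHom.ker_isPrime _
  have hinj : Set.InjOn (fun b ↦ RingHom.ker (Ψ b)) S := by
    intro b hb b' hb' heq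
    by_contra hne
    have h1 := hcop b hb b' hb' hne
    simp only at heq
    rw [← heq, Ideal.isCoprime_iff_sup_eq, sup_idem] at h1
    exact (hprime b).ne_top h1
  refine ⟨S.image fun b ↦ RingHom.ker (Ψ b), ?_, ?_, ?_⟩
  · rw [Finset.card_image_of_injOn hinj, hS]
  · simp only [Finset.mem_image, forall_exists_index, and_imp]
    rintro _ b _ rfl
    exact hprime b
  · rw [Finset.prod_image hinj, Ideal.prod_eq_iInf_of_pairwise_isCoprime
      fun b hb b' hb' hne ↦ hcop b hb b' hb' hne]
    refine le_antisymm (le_iInf₂ fun b hb ↦ map_ker_le_ker (hΨ b hb)) fun a ha ↦ ?_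
    simp only [Submodule.mem_iInf] at ha
    obtain ⟨h, hlt, hh⟩ := exists_degree_lt_of_generated hg hgθ H a
    have h0 : h.map φ = 0 := by
      refine Polynomial.eq_zero_of_degree_lt_of_eval_finset_eq_zero S ?_ fun b hb ↦ ?_
      · rw [hS, ← degree_eq_natDegree hg.ne_zero]
        exact (degree_map_le).trans_lt hlt
      · rw [← hΨθ b hb, eval_map_eq_of_sub_mem (hΨ b hb) hh]
        exact ha b hb
    simpa using Ideal.add_mem _ hh (eval₂_mem_map_ker (ι := ι) (θ := θ) h0)

end Extension

/-- An irreducible monic integer polynomial divides every integer polynomial with which it has a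
common zero in a domain of characteristic `0`. -/
theorem dvd_of_aeval_eq_zero {A : Type*} [CommRing A] [IsDomain A] [CharZero A] {f : ℤ[X]}
    (hf : f.Monic) (hirr : Irreducible f) {x : A} (hx : aeval x f = 0) {h : ℤ[X]}
    (hh : aeval x h = 0) : f ∣ h := by
  have hint : IsIntegral ℤ x := ⟨f, hf, hx⟩
  have h1 : minpoly ℤ x ∣ f := minpoly.isIntegrallyClosed_dvd hint hx
  have h2 : Associated (minpoly ℤ x) f := by
    exact hirr.dvd_iff.mp h1 |>.resolve_left (minpoly.not_isUnit ℤ x) |>.symm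
  exact h2.symm.dvd.trans (minpoly.isIntegrallyClosed_dvd hint hh)

theorem minpoly_int_eq {A : Type*} [CommRing A] [IsDomain A] [CharZero A] {f : ℤ[X]}
    (hf : f.Monic) (hirr : Irreducible f) {x : A} (hx : aeval x f = 0) : minpoly ℤ x = f := by
  have hint : IsIntegral ℤ x := ⟨f, hf, hx⟩
  refine eq_of_monic_of_associated (minpoly.monic hint) hf ?_
  exact associated_of_dvd_dvd (minpoly.isIntegrallyClosed_dvd hint hx)
    (dvd_of_aeval_eq_zero hf hirr hx (minpoly.aeval ℤ x))

/-- The derivative of the minimal polynomial at a generator conducts the ring of integers into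
the order spanned by the generator. -/
theorem exists_aeval_eq_derivative_mul {K : Type*} [Field K] [NumberField K] (x : 𝓞 K)
    (hx : Algebra.adjoin ℚ {(x : K)} = ⊤) (y : 𝓞 K) :
    ∃ h : ℤ[X], aeval x (derivative (minpoly ℤ x)) * y = aeval x h := by
  have h1 := conductor_mul_differentIdeal ℤ ℚ K x hx
  have h2 : aeval x (derivative (minpoly ℤ x)) ∈ conductor ℤ x := by
    apply Ideal.mul_le_left (J := differentIdeal ℤ (𝓞 K))
    rw [h1]
    exact Ideal.mem_span_singleton_self _
  have h3 := h2 y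
  rw [Algebra.adjoin_singleton_eq_range_aeval] at h3
  obtain ⟨h, hh⟩ := h3
  exact ⟨h, hh.symm⟩

/-! ### The tower in characteristic `0`: degrees and conductors. -/

section Tower

theorem IsCompatible.eval_eq {ℓ : ℕ} {t : ℤ} {L : Type*} [Field L] {θ : ℕ → L}
    (hθ : IsCompatible ℓ t θ) {m n : ℕ} (hmn : m ≤ n) :
    (Chebyshev.C L ((ℓ ^ (n - m) : ℕ) : ℤ)).eval (θ n) = θ m := by
  rw [← chebMap_iterate]
  induction n, hmn using Nat.le_induction with
  | base => simp
  | succ n hmn ih =>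
    rw [Nat.sub_add_comm hmn, Function.iterate_succ_apply, hθ.2, ih]

theorem IsCompatible.aeval_sub_eq_zero {ℓ : ℕ} {t : ℤ} {L : Type*} [Field L] {θ : ℕ → L}
    (hθ : IsCompatible ℓ t θ) (n : ℕ) :
    aeval (θ n) (Chebyshev.C ℤ ((ℓ ^ n : ℕ) : ℤ) - Polynomial.C t) = 0 := by
  have := hθ.eval_eq (Nat.zero_le n)
  rw [Nat.sub_zero, hθ.1] at this
  rw [map_sub, Chebyshev.aeval_C, this]
  simp

theorem ell_pow_pos {ℓ : ℕ} [Fact ℓ.Prime] (n : ℕ) : 0 < ℓ ^ n := pow_pos (Fact.out : ℓ.Prime).pos n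

theorem IsCompatible.isIntegral {ℓ : ℕ} [Fact ℓ.Prime] {t : ℤ} {L : Type*} [Field L] {θ : ℕ → L}
    (hθ : IsCompatible ℓ t θ) (n : ℕ) : IsIntegral ℤ (θ n) :=
  ⟨_, chebyshev_sub_C_monic (ell_pow_pos n) t, hθ.aeval_sub_eq_zero n⟩

variable {ℓ p : ℕ} {t : ℤ} {L : Type*} [Field L] [CharZero L] {θ : ℕ → L}

theorem irreducible_chebyshev_sub
    (hirr : ∀ n : ℕ, 1 ≤ n → Irreducible (chebIter ℓ ℤ n - Polynomial.C t)) (n : ℕ) :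
    Irreducible (Chebyshev.C ℤ ((ℓ ^ n : ℕ) : ℤ) - Polynomial.C t) := by
  rcases Nat.eq_zero_or_pos n with rfl | hn
  · simpa using irreducible_X_sub_C t
  · rw [← chebIter_eq]
    exact hirr n hn

theorem not_dvd_conductor_bound (hpp : p.Prime) (hp : ¬ (p : ℤ) ∣ (ℓ : ℤ) * (4 - t ^ 2)) (n : ℕ) :
    ¬ (p : ℤ) ∣ ((ℓ ^ n : ℕ) : ℤ) ^ 2 * (t ^ 2 - 4) := by
  intro h
  have hp' : Prime (p : ℤ) := Nat.prime_iff_prime_int.mp hpp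
  apply hp
  rcases hp'.dvd_or_dvd h with h | h
  · push_cast at h
    exact (hp'.dvd_of_dvd_pow (hp'.dvd_of_dvd_pow h)).mul_right _
  · exact (dvd_sub_comm.mp h).mul_left _

theorem level_le_levelInfty (θ : ℕ → L) (n : ℕ) : level θ n ≤ levelInfty θ := le_iSup (level θ) n

theorem IsCompatible.level_mono (hθ : IsCompatible ℓ t θ) : Monotone (level θ) := by
  intro m n hmn
  rw [level, IntermediateField.adjoin_simple_le_iff, ← hθ.eval_eq hmn,
    ← Chebyshev.aeval_C (R := ℚ)]
  exact IntermediateField.algebra_adjoin_le_adjoin _ _ (aeval_mem_adjoin_singleton _ _)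

variable [Fact ℓ.Prime]

/-- The point `θ n` as an element of the ring of integers of a field containing it. -/
def IsCompatible.intPoint (hθ : IsCompatible ℓ t θ) {F : IntermediateField ℚ L} {n : ℕ}
    (h : level θ n ≤ F) : 𝓞 F :=
  ⟨⟨θ n, h (IntermediateField.mem_adjoin_simple_self ℚ (θ n))⟩,
    (isIntegral_algHom_iff (F.val.restrictScalars ℤ) Subtype.val_injective).mp (hθ.isIntegral n)⟩

/-- The ring of integers of an intermediate field, embedded into the ambient field. -/
def intVal (F : IntermediateField ℚ L) : 𝓞 F →+* L := F.val.toRingHom.comp (algebraMap (𝓞 F) F)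

theorem intVal_injective (F : IntermediateField ℚ L) : Function.Injective (intVal F) :=
  Subtype.val_injective.comp RingOfIntegers.coe_injective

theorem IsCompatible.intVal_intPoint (hθ : IsCompatible ℓ t θ) {F : IntermediateField ℚ L}
    {n : ℕ} (h : level θ n ≤ F) : intVal F (hθ.intPoint h) = θ n := rfl

theorem IsCompatible.ringInclusion_intPoint (hθ : IsCompatible ℓ t θ)
    {E F : IntermediateField ℚ L} (h : E ≤ F) {n : ℕ} (hn : level θ n ≤ E) :
    ringInclusion h (hθ.intPoint hn) = hθ.intPoint (hn.trans h) := rfl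

theorem IsCompatible.eval_intPoint (hθ : IsCompatible ℓ t θ) {F : IntermediateField ℚ L}
    {m n : ℕ} (hmn : m ≤ n) (hm : level θ m ≤ F) (hn : level θ n ≤ F) :
    aeval (hθ.intPoint hn) (Chebyshev.C ℤ ((ℓ ^ (n - m) : ℕ) : ℤ)) = hθ.intPoint hm := by
  apply intVal_injective F
  rw [map_aeval_int, hθ.intVal_intPoint, hθ.intVal_intPoint, Chebyshev.aeval_C, hθ.eval_eq hmn]

theorem IsCompatible.aeval_intPoint_eq_zero (hθ : IsCompatible ℓ t θ)
    {F : IntermediateField ℚ L} {n : ℕ} (hn : level θ n ≤ F) :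
    aeval (hθ.intPoint hn) (Chebyshev.C ℤ ((ℓ ^ n : ℕ) : ℤ) - Polynomial.C t) = 0 := by
  apply intVal_injective F
  rw [map_aeval_int, hθ.intVal_intPoint, hθ.aeval_sub_eq_zero, map_zero]

theorem IsCompatible.finrank_level (hθ : IsCompatible ℓ t θ)
    (hirr : ∀ n : ℕ, 1 ≤ n → Irreducible (chebIter ℓ ℤ n - Polynomial.C t)) (n : ℕ) :
    Module.finrank ℚ (level θ n) = ℓ ^ n := by
  have hm := chebyshev_sub_C_monic (ell_pow_pos (ℓ := ℓ) n) t
  rw [level, IntermediateField.adjoin.finrank (hθ.isIntegral n).tower_top,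
    minpoly.isIntegrallyClosed_eq_field_fractions' ℚ (hθ.isIntegral n),
    (minpoly.monic (hθ.isIntegral n)).natDegree_map,
    minpoly_int_eq hm (irreducible_chebyshev_sub hirr n) (hθ.aeval_sub_eq_zero n),
    chebyshev_sub_C_natDegree (ell_pow_pos n)]

theorem IsCompatible.numberField_level (hθ : IsCompatible ℓ t θ) (n : ℕ) :
    NumberField (level θ n) where
  to_charZero := inferInstance
  to_finiteDimensional :=
    IntermediateField.adjoin.finiteDimensional (hθ.isIntegral n).tower_top

theorem aeval_derivative_chebyshev_dvd {A : Type*} [CommRing A] {x : A} {N : ℕ}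
    (hx : aeval x (Chebyshev.C ℤ (N : ℤ) - Polynomial.C t) = 0) :
    aeval x (derivative (Chebyshev.C ℤ (N : ℤ) - Polynomial.C t)) *
      aeval x ((X ^ 2 - 4) * derivative (Chebyshev.C ℤ (N : ℤ))) =
      (((N : ℤ) ^ 2 * (t ^ 2 - 4) : ℤ) : A) := by
  have h := congrArg (aeval x) (X_sq_sub_four_mul_derivative_chebyshev_sq (R := ℤ) N)
  have hT : aeval x (Chebyshev.C ℤ (N : ℤ)) = (t : A) := by
    simpa [sub_eq_zero] using hx
  rw [derivative_sub, derivative_C, sub_zero]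
  simp only [map_mul, map_sub, map_pow, hT] at h ⊢
  simp only [map_natCast, map_ofNat] at h ⊢
  push_cast
  linear_combination h

/-- The derivative of the minimal polynomial conducts `𝓞 K_n` into `ℤ[θ n]`, and it divides this
integer by `aeval_derivative_chebyshev_dvd`. -/
theorem IsCompatible.exists_mul_eq_aeval_level (hθ : IsCompatible ℓ t θ)
    (hirr : ∀ n : ℕ, 1 ≤ n → Irreducible (chebIter ℓ ℤ n - Polynomial.C t)) (n : ℕ)
    (x : 𝓞 (level θ n)) :
    ∃ h : ℤ[X], ((((ℓ ^ n : ℕ) : ℤ) ^ 2 * (t ^ 2 - 4) : ℤ) : 𝓞 (level θ n)) * x =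
      aeval (hθ.intPoint (le_refl (level θ n))) h := by
  have := hθ.numberField_level n
  set y := hθ.intPoint (le_refl (level θ n)) with hy
  have hgen : Algebra.adjoin ℚ {(y : level θ n)} = ⊤ := by
    refine eq_top_iff.mpr fun z _ ↦ ?_
    have hz : (z : L) ∈ (level θ n).toSubalgebra := z.2
    change _ ∈ (IntermediateField.adjoin ℚ {θ n}).toSubalgebra at hz
    rw [IntermediateField.adjoin_simple_toSubalgebra_of_isAlgebraic
      (hθ.isIntegral n).tower_top.isAlgebraic, Algebra.adjoin_singleton_eq_range_aeval] at hz
    obtain ⟨q, hq⟩ := hz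
    have hzq : z = aeval (y : level θ n) q := by
      apply Subtype.val_injective
      rw [← hq]
      exact (aeval_algHom_apply (level θ n).val (y : level θ n) q)
    rw [hzq]
    exact aeval_mem_adjoin_singleton _ _
  have hy0 := hθ.aeval_intPoint_eq_zero (le_refl (level θ n))
  have hmin : minpoly ℤ y = Chebyshev.C ℤ ((ℓ ^ n : ℕ) : ℤ) - Polynomial.C t :=
    minpoly_int_eq (chebyshev_sub_C_monic (ell_pow_pos n) t) (irreducible_chebyshev_sub hirr n) hy0
  obtain ⟨h, hh⟩ := exists_aeval_eq_derivative_mul y hgen x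
  rw [hmin] at hh
  refine ⟨(X ^ 2 - 4) * derivative (Chebyshev.C ℤ ((ℓ ^ n : ℕ) : ℤ)) * h, ?_⟩
  rw [← aeval_derivative_chebyshev_dvd hy0, map_mul _ _ h, ← hh]
  ring

theorem IsCompatible.isGeneratedPrimeTo_level (hθ : IsCompatible ℓ t θ)
    (hirr : ∀ n : ℕ, 1 ≤ n → Irreducible (chebIter ℓ ℤ n - Polynomial.C t))
    (hpp : p.Prime) (hp : ¬ (p : ℤ) ∣ (ℓ : ℤ) * (4 - t ^ 2)) (n : ℕ) :
    IsGeneratedPrimeTo p fun _ : ℕ ↦ hθ.intPoint (le_refl (level θ n)) := by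
  intro x
  obtain ⟨h, hh⟩ := hθ.exists_mul_eq_aeval_level hirr n x
  exact ⟨0, _, h, not_dvd_conductor_bound hpp hp n, hh⟩

theorem IsCompatible.isGeneratedPrimeTo_levelInfty (hθ : IsCompatible ℓ t θ)
    (hirr : ∀ n : ℕ, 1 ≤ n → Irreducible (chebIter ℓ ℤ n - Polynomial.C t))
    (hpp : p.Prime) (hp : ¬ (p : ℤ) ∣ (ℓ : ℤ) * (4 - t ^ 2)) :
    IsGeneratedPrimeTo p fun n : ℕ ↦ hθ.intPoint (level_le_levelInfty θ n) := by
  intro x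
  have hx : ((x : levelInfty θ) : L) ∈ ⨆ n, level θ n := (x : levelInfty θ).2
  rw [← SetLike.mem_coe, IntermediateField.coe_iSup_of_directed hθ.level_mono.directed_le,
    Set.mem_iUnion] at hx
  obtain ⟨n, hn⟩ := hx
  have hint : IsIntegral ℤ ((x : levelInfty θ) : L) :=
    x.isIntegral_coe.map ((levelInfty θ).val.restrictScalars ℤ)
  let y : 𝓞 (level θ n) := ⟨⟨_, hn⟩, (isIntegral_algHom_iff
    ((level θ n).val.restrictScalars ℤ) Subtype.val_injective).mp hint⟩
  obtain ⟨h, hh⟩ := hθ.exists_mul_eq_aeval_level hirr n y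
  refine ⟨n, _, h, not_dvd_conductor_bound hpp hp n, ?_⟩
  have h1 := congrArg (ringInclusion (level_le_levelInfty θ n)) hh
  rw [map_mul, map_intCast, map_aeval_int, hθ.ringInclusion_intPoint] at h1
  exact h1

end Tower

theorem chebyshev_sq_sub_four {R : Type*} [CommRing R] (n : ℕ) :
    Chebyshev.C R (n : ℤ) ^ 2 - 4 = ((X : R[X]) ^ 2 - 4) * Chebyshev.S R ((n : ℤ) - 1) ^ 2 := by
  have h1 := Chebyshev.C_eq_S_sub_X_mul_S R (n : ℤ)
  have h2 := Chebyshev.S_sq_add_S_sq R ((n : ℤ) - 1)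
  rw [sub_add_cancel] at h2
  rw [h1]
  linear_combination (4 : R[X]) * h2

/-- The critical set `x² = 4` is mapped into itself, so avoiding it at the bottom means avoiding it
at every level. -/
theorem sq_ne_four_of_chebyshev {R : Type*} [CommRing R] {n : ℕ} {x a : R}
    (hx : (Chebyshev.C R (n : ℤ)).eval x = a) (ha : a ^ 2 ≠ 4) : x ^ 2 ≠ 4 := by
  intro h
  have h1 := congrArg (eval x) (chebyshev_sq_sub_four (R := R) n)
  simp only [eval_sub, eval_pow, eval_mul, eval_X, eval_ofNat, hx] at h1
  rw [h, sub_self, zero_mul, sub_eq_zero] at h1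
  exact ha h1

/-! ### Roots, Frobenius and residue fields in characteristic `p`. -/

section Field

variable {κ : Type*} [Field κ]

/-- Modulo `F` the derivative identity reads `(X² - 4) F'² = N² (a² - 4)`, a nonzero constant, which
is a Bézout relation for `F` and `F'`. -/
theorem separable_chebyshev_sub_C {N : ℕ} (hN : (N : κ) ≠ 0) {a : κ} (ha : a ^ 2 ≠ 4) :
    (Chebyshev.C κ (N : ℤ) - Polynomial.C a).Separable := by
  set F := Chebyshev.C κ (N : ℤ) - Polynomial.C a with hF
  have h := X_sq_sub_four_mul_derivative_chebyshev_sq (R := κ) N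
  have hd : derivative F = derivative (Chebyshev.C κ (N : ℤ)) := by simp [hF]
  rw [← hd, show Chebyshev.C κ (N : ℤ) = F + Polynomial.C a by simp [hF]] at h
  have hk : (N : κ) ^ 2 * (a ^ 2 - 4) ≠ 0 :=
    mul_ne_zero (pow_ne_zero _ hN) (sub_ne_zero.mpr ha)
  have hk' : Polynomial.C ((N : κ) ^ 2 * (a ^ 2 - 4))⁻¹ *
      ((N : κ[X]) ^ 2 * (Polynomial.C a ^ 2 - 4)) = 1 := by
    have : ((N : κ[X]) ^ 2 * (Polynomial.C a ^ 2 - 4)) =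
        Polynomial.C ((N : κ) ^ 2 * (a ^ 2 - 4)) := by
      rw [Polynomial.C_mul, Polynomial.C_sub, Polynomial.C_pow, Polynomial.C_pow, map_natCast,
        map_ofNat]
    rw [this, ← Polynomial.C_mul, inv_mul_cancel₀ hk, Polynomial.C_1]
  refine ⟨-(Polynomial.C ((N : κ) ^ 2 * (a ^ 2 - 4))⁻¹) * (N : κ[X]) ^ 2 *
    (F + 2 * Polynomial.C a),
    Polynomial.C ((N : κ) ^ 2 * (a ^ 2 - 4))⁻¹ * (X ^ 2 - 4) * derivative F, ?_⟩
  linear_combination Polynomial.C ((N : κ) ^ 2 * (a ^ 2 - 4))⁻¹ * h + hk'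

theorem exists_finset_chebyshev_eq [IsAlgClosed κ] {N : ℕ} (hN : (N : κ) ≠ 0) {a : κ}
    (ha : a ^ 2 ≠ 4) :
    ∃ S : Finset κ, S.card = N ∧ ∀ b ∈ S, (Chebyshev.C κ (N : ℤ)).eval b = a := by
  classical
  have hpos : 0 < N := Nat.pos_of_ne_zero (by rintro rfl; simp at hN)
  refine ⟨(Chebyshev.C κ (N : ℤ) - Polynomial.C a).roots.toFinset, ?_, fun b hb ↦ ?_⟩
  · rw [Multiset.toFinset_card_of_nodup (nodup_roots (separable_chebyshev_sub_C hN ha)),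
      ← (IsAlgClosed.splits _).natDegree_eq_card_roots, chebyshev_sub_C_natDegree hpos]
  · have := isRoot_of_mem_roots (Multiset.mem_toFinset.mp hb)
    simpa [sub_eq_zero] using this

theorem exists_chebyshev_eq [IsAlgClosed κ] {N : ℕ} (hN : 0 < N) (a : κ) :
    ∃ b : κ, (Chebyshev.C κ (N : ℤ)).eval b = a := by
  obtain ⟨b, hb⟩ := IsAlgClosed.exists_root (Chebyshev.C κ (N : ℤ) - Polynomial.C a) (by
    rw [degree_eq_natDegree (chebyshev_sub_C_monic hN a).ne_zero, chebyshev_sub_C_natDegree hN]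
    exact_mod_cast hN.ne')
  exact ⟨b, by simpa [sub_eq_zero] using hb⟩

theorem intCast_ker {p : ℕ} [CharP κ p] :
    RingHom.ker (Int.castRingHom κ) = Ideal.span {(p : ℤ)} := by
  ext x
  rw [RingHom.mem_ker, Ideal.mem_span_singleton, eq_intCast, CharP.intCast_eq_zero_iff κ p]

variable {p : ℕ} [Fact p.Prime] [CharP κ p]

theorem pow_pow_injective (r : ℕ) : Function.Injective fun x : κ ↦ x ^ p ^ r :=
  iterateFrobenius_inj κ p r

/-- A polynomial over the fixed field of the `p ^ r`-power map which vanishes at a point with at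
least `N` conjugates, but has degree less than `N`, is zero. -/
theorem eq_zero_of_conjugates {r N : ℕ} {F : κ[X]} (hdeg : F.degree < N)
    (hF : ∀ i, F.coeff i ^ p ^ r = F.coeff i) {b : κ} (hb : F.eval b = 0)
    (hconj : ∀ k, 0 < k → k < N → b ^ (p ^ r) ^ k ≠ b) : F = 0 := by
  have hroot : ∀ k, F.eval (b ^ (p ^ r) ^ k) = 0 := by
    intro k
    induction k with
    | zero => simpa using hb
    | succ k ih =>
      have h1 : F.map (iterateFrobenius κ p r) = F := by
        ext i
        rw [coeff_map, iterateFrobenius_def, hF]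
      rw [pow_succ, pow_mul, ← iterateFrobenius_def (R := κ) p r, ← h1, eval_map, eval₂_at_apply,
        ih, map_zero]
  have hne : ∀ i j, i < j → j < N → b ^ (p ^ r) ^ i ≠ b ^ (p ^ r) ^ j := by
    intro i j hij hj heq
    apply hconj (j - i) (Nat.sub_pos_of_lt hij) ((Nat.sub_le _ _).trans_lt hj)
    apply pow_pow_injective (p := p) (r * i)
    simp only
    rw [pow_mul p, ← pow_mul, ← pow_add, Nat.sub_add_cancel hij.le, heq]
  have hinj : Function.Injective fun i : Fin N ↦ b ^ (p ^ r) ^ (i : ℕ) := by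
    intro i j hij
    rcases lt_trichotomy (i : ℕ) j with h | h | h
    · exact absurd hij (hne _ _ h j.2)
    · exact Fin.ext h
    · exact absurd hij.symm (hne _ _ h i.2)
  exact eq_zero_of_degree_lt_of_eval_index_eq_zero (s := Finset.univ)
    (v := fun i : Fin N ↦ b ^ (p ^ r) ^ (i : ℕ)) (fun i _ j _ h ↦ hinj h) (by simpa using hdeg)
    fun i _ ↦ hroot i

theorem mem_range_intCast_of_pow_eq {x : κ} (hx : x ^ p = x) : ∃ z : ℤ, (z : κ) = x := by
  have h := (Subfield.mem_bot_iff_pow_eq_self κ p).mpr hx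
  have h2 : x ∈ (ZMod.castHom (dvd_refl p) κ).fieldRange :=
    (bot_le : (⊥ : Subfield κ) ≤ _) h
  obtain ⟨y, hy⟩ := h2
  obtain ⟨z, rfl⟩ := ZMod.intCast_surjective y
  exact ⟨z, by simpa using hy⟩

/-- Counting: the elements `a + b φ(z)` with `a, b ∈ 𝔽_p` are `p²` distinct roots of `X ^ p² - X`,
hence all of them. -/
theorem mem_range_of_pow_sq_eq {A : Type*} [CommRing A] (φ : A →+* κ)
    (hφ : ∀ x, φ x ^ p ^ 2 = φ x) {z : A} (hz : φ z ^ p ≠ φ z) {x : κ} (hx : x ^ p ^ 2 = x) :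
    x ∈ φ.range := by
  classical
  have hp1 : 1 < p := (Fact.out : p.Prime).one_lt
  have hlt : 1 < p ^ 2 := Nat.one_lt_pow two_ne_zero hp1
  set S : Finset κ := (X ^ p ^ 2 - X : κ[X]).roots.toFinset with hS
  have hne : (X ^ p ^ 2 - X : κ[X]) ≠ 0 := FiniteField.X_pow_card_sub_X_ne_zero κ hlt
  have hmem : ∀ y : κ, y ∈ S ↔ y ^ p ^ 2 = y := by
    intro y
    simp [hS, hne, sub_eq_zero]
  have hcard : S.card ≤ p ^ 2 := by
    refine (Multiset.toFinset_card_le _).trans ((card_roots' _).trans ?_)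
    rw [FiniteField.X_pow_card_sub_X_natDegree_eq _ hlt]
  let f : ZMod p × ZMod p → κ := fun w ↦ φ ((w.1.val : A) + (w.2.val : A) * z)
  have hf : ∀ w, f w = ZMod.castHom (dvd_refl p) κ w.1 +
      ZMod.castHom (dvd_refl p) κ w.2 * φ z := by
    intro w
    simp only [f, map_add, map_mul, map_natCast]
    simp only [ZMod.natCast_val, ZMod.castHom_apply]
  have hinj : Function.Injective f := by
    rintro ⟨a, b⟩ ⟨a', b'⟩ h
    rw [hf, hf] at h
    simp only at h
    have hb : b = b' := by
      by_contra hbb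
      have h0 : ZMod.castHom (dvd_refl p) κ (b - b') ≠ 0 := by
        rw [Ne, map_eq_zero, sub_eq_zero]; exact hbb
      have h1 : φ z = ZMod.castHom (dvd_refl p) κ ((a' - a) / (b - b')) := by
        rw [map_div₀, eq_div_iff h0, map_sub, map_sub]
        linear_combination h
      apply hz
      rw [h1, ← map_pow, ZMod.pow_card]
    subst hb
    have ha : ZMod.castHom (dvd_refl p) κ a = ZMod.castHom (dvd_refl p) κ a' := by
      linear_combination h
    rw [(ZMod.castHom (dvd_refl p) κ).injective ha]
  have himg : Finset.univ.image f = S := by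
    refine Finset.eq_of_subset_of_card_le (fun y hy ↦ ?_) ?_
    · obtain ⟨w, -, rfl⟩ := Finset.mem_image.mp hy
      exact (hmem _).mpr (hφ _)
    · rw [Finset.card_image_of_injective _ hinj, Finset.card_univ, Fintype.card_prod, ZMod.card,
        ← sq]
      exact hcard
  have hxS := (hmem x).mpr hx
  rw [← himg] at hxS
  obtain ⟨w, -, rfl⟩ := Finset.mem_image.mp hxS
  exact ⟨_, rfl⟩

theorem isMaximal_of_mem {A : Type*} [CommRing A] [Algebra.IsIntegral ℤ A] (P : Ideal A)
    [hP : P.IsPrime] (hp : (p : A) ∈ P) : P.IsMaximal := by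
  apply Ideal.isMaximal_of_isIntegral_of_isMaximal_comap (R := ℤ)
  have hspan : (Ideal.span {(p : ℤ)}).IsMaximal := Int.ideal_span_isMaximal_of_prime p
  rw [← hspan.eq_of_le (Ideal.IsPrime.ne_top (hP.comap _))]
  · exact hspan
  · rw [Ideal.span_singleton_le_iff_mem]
    simpa using hp

/-- The residue field is algebraic over `𝔽_p`, so it embeds in `κ`. -/
theorem exists_ringHom_ker_eq [IsAlgClosed κ] {A : Type*} [CommRing A] [Algebra.IsIntegral ℤ A]
    (P : Ideal A) [hP : P.IsPrime] (hp : (p : A) ∈ P) : ∃ φ : A →+* κ, RingHom.ker φ = P := by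
  have hmax := isMaximal_of_mem P hp
  let := Ideal.Quotient.field P
  have hpP : (p : A ⧸ P) = 0 := by
    rw [← map_natCast (Ideal.Quotient.mk P), Ideal.Quotient.eq_zero_iff_mem]
    exact hp
  have : CharP (A ⧸ P) p := (CharP.charP_iff_prime_eq_zero Fact.out).mpr hpP
  let := ZMod.algebra (A ⧸ P) p
  let := ZMod.algebra κ p
  have hint : Algebra.IsIntegral (ZMod p) (A ⧸ P) := by
    constructor
    intro x
    obtain ⟨y, rfl⟩ := Ideal.Quotient.mk_surjective x
    have h1 : IsIntegral ℤ (Ideal.Quotient.mk P y) :=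
      (Algebra.IsIntegral.isIntegral (R := ℤ) y).map (Ideal.Quotient.mkₐ ℤ P)
    exact h1.tower_top
  let f : (A ⧸ P) →ₐ[ZMod p] κ := IsAlgClosed.lift
  refine ⟨f.toRingHom.comp (Ideal.Quotient.mk P), ?_⟩
  rw [← RingHom.comap_ker, (RingHom.injective_iff_ker_eq_bot _).mp f.toRingHom.injective,
    ← RingHom.ker_eq_comap_bot, Ideal.mk_ker]

end Field

/-- With `u c + w p = 1`, the elements `a` and `u (c a)` differ by a multiple of `p`, which lies in
the extended ideal. -/
theorem IsGeneratedPrimeTo.exists_sub_eval₂_mem {p : ℕ} (hpp : p.Prime) {A : Type*} [CommRing A]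
    {x : A} (hA : IsGeneratedPrimeTo p fun _ : ℕ ↦ x) {R : Type*} [CommRing R] (ι : R →+* A)
    {I : Ideal R} (hI : (p : R) ∈ I) (a : A) : ∃ h : R[X], a - h.eval₂ ι x ∈ I.map ι := by
  obtain ⟨_, c, h, hc, hh⟩ := hA a
  obtain ⟨u, w, huw⟩ : IsCoprime c (p : ℤ) :=
    ((Nat.prime_iff_prime_int.mp hpp).coprime_iff_not_dvd.mpr hc).symm
  refine ⟨(Polynomial.C u * h).map (Int.castRingHom R), ?_⟩
  have h1 : ((Polynomial.C u * h).map (Int.castRingHom R)).eval₂ ι x = (u : A) * ((c : A) * a) := by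
    rw [eval₂_map, RingHom.eq_intCast' (ι.comp (Int.castRingHom R)), eval₂_mul, eval₂_C, hh]
    rfl
  have h2 : a - (u : A) * ((c : A) * a) = (w : A) * a * ι (p : R) := by
    have h3 : (u : A) * c + w * p = 1 := by exact_mod_cast congrArg (Int.cast (R := A)) huw
    rw [map_natCast]
    linear_combination (-a) * h3
  rw [h1, h2]
  exact Ideal.mul_mem_left _ _ (Ideal.mem_map_of_mem _ hI)

section Field

variable {κ : Type*} [Field κ]

theorem eval_chebyshev_trans {ℓ m n : ℕ} (hmn : m ≤ n) {b c : κ} {a : κ}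
    (hb : (Chebyshev.C κ ((ℓ ^ (n - m) : ℕ) : ℤ)).eval b = c)
    (hc : (Chebyshev.C κ ((ℓ ^ m : ℕ) : ℤ)).eval c = a) :
    (Chebyshev.C κ ((ℓ ^ n : ℕ) : ℤ)).eval b = a := by
  rw [← chebMap_iterate] at *
  rw [← hc, ← hb, ← Function.iterate_add_apply, Nat.add_sub_cancel' hmn]

theorem sq_ne_four_of_not_dvd {ℓ p : ℕ} [CharP κ p] {t : ℤ}
    (hp : ¬ (p : ℤ) ∣ (ℓ : ℤ) * (4 - t ^ 2)) : (t : κ) ^ 2 ≠ 4 := by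
  intro h
  apply hp
  apply Dvd.dvd.mul_left
  rw [← CharP.intCast_eq_zero_iff κ p]
  push_cast
  rw [h, sub_self]

theorem ell_pow_ne_zero_of_not_dvd {ℓ p : ℕ} [Fact p.Prime] [CharP κ p] {t : ℤ}
    (hp : ¬ (p : ℤ) ∣ (ℓ : ℤ) * (4 - t ^ 2)) (n : ℕ) :
    ((ℓ ^ n : ℕ) : κ) ≠ 0 := by
  intro h
  apply hp
  apply Dvd.dvd.mul_right
  rw [CharP.cast_eq_zero_iff κ p] at h
  exact_mod_cast (Fact.out : p.Prime).dvd_of_dvd_pow h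

end Field

/-! ### Decomposition of `p` in terms of the points over `t` in characteristic `p`. -/

section Tower

variable {ℓ p : ℕ} [Fact ℓ.Prime] [Fact p.Prime] {t : ℤ} {L : Type*} [Field L] [CharZero L]
  {θ : ℕ → L} {κ : Type*} [Field κ] [CharP κ p]

/-- All integer relations of `θ n` are multiples of its irreducible monic polynomial, of which `b`
is a root. -/
theorem IsCompatible.exists_ringHom_level (hθ : IsCompatible ℓ t θ)
    (hirr : ∀ n : ℕ, 1 ≤ n → Irreducible (chebIter ℓ ℤ n - Polynomial.C t))
    (hp : ¬ (p : ℤ) ∣ (ℓ : ℤ) * (4 - t ^ 2)) (n : ℕ) {b : κ}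
    (hb : (Chebyshev.C κ ((ℓ ^ n : ℕ) : ℤ)).eval b = t) :
    ∃ φ : 𝓞 (level θ n) →+* κ, φ (hθ.intPoint (le_refl (level θ n))) = b := by
  obtain ⟨φ, hφ⟩ := (hθ.isGeneratedPrimeTo_level hirr Fact.out hp n).exists_ringHom (p := p)
    (fun _ ↦ b) (fun _ ↦ X) (fun _ ↦ by simp) (fun _ ↦ by simp) (fun _ h hh ↦ by
      obtain ⟨g, rfl⟩ := dvd_of_aeval_eq_zero (chebyshev_sub_C_monic (ell_pow_pos n) t)
        (irreducible_chebyshev_sub hirr n) (hθ.aeval_intPoint_eq_zero (le_refl (level θ n))) hh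
      rw [map_mul, map_sub, Chebyshev.aeval_C, hb]
      simp)
  exact ⟨φ, hφ 0⟩

theorem IsCompatible.exists_ringHom_levelInfty (hθ : IsCompatible ℓ t θ)
    (hirr : ∀ n : ℕ, 1 ≤ n → Irreducible (chebIter ℓ ℤ n - Polynomial.C t))
    (hp : ¬ (p : ℤ) ∣ (ℓ : ℤ) * (4 - t ^ 2)) {b : ℕ → κ} (hb : IsCompatible ℓ t b) :
    ∃ φ : 𝓞 (levelInfty θ) →+* κ, ∀ n, φ (hθ.intPoint (level_le_levelInfty θ n)) = b n := by
  refine (hθ.isGeneratedPrimeTo_levelInfty hirr Fact.out hp).exists_ringHom (p := p) b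
    (fun _ ↦ Chebyshev.C ℤ ((ℓ : ℕ) : ℤ)) (fun n ↦ ?_) (fun n ↦ ?_) (fun n h hh ↦ ?_)
  · simpa using hθ.eval_intPoint n.le_succ (level_le_levelInfty θ n) (level_le_levelInfty θ (n + 1))
  · rw [Chebyshev.aeval_C]
    exact hb.2 n
  · obtain ⟨g, rfl⟩ := dvd_of_aeval_eq_zero (chebyshev_sub_C_monic (ell_pow_pos n) t)
      (irreducible_chebyshev_sub hirr n) (hθ.aeval_intPoint_eq_zero (level_le_levelInfty θ n)) hh
    have h1 := hb.eval_eq (Nat.zero_le n)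
    rw [Nat.sub_zero, hb.1] at h1
    rw [map_mul, map_sub, Chebyshev.aeval_C, h1]
    simp

theorem IsCompatible.ringHom_level_ext (hθ : IsCompatible ℓ t θ)
    (hirr : ∀ n : ℕ, 1 ≤ n → Irreducible (chebIter ℓ ℤ n - Polynomial.C t))
    (hp : ¬ (p : ℤ) ∣ (ℓ : ℤ) * (4 - t ^ 2)) {n : ℕ} {φ ψ : 𝓞 (level θ n) →+* κ}
    (h : φ (hθ.intPoint (le_refl (level θ n))) = ψ (hθ.intPoint (le_refl (level θ n)))) :
    φ = ψ :=
  (hθ.isGeneratedPrimeTo_level hirr (Fact.out : p.Prime) hp n).ringHom_ext fun _ ↦ h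

/-- Every ring homomorphism out of the ring of integers of `K_n` sends `θ n` to a point over
`t`. -/
theorem IsCompatible.eval_ringHom_level (hθ : IsCompatible ℓ t θ) {n : ℕ}
    (φ : 𝓞 (level θ n) →+* κ) :
    (Chebyshev.C κ ((ℓ ^ n : ℕ) : ℤ)).eval (φ (hθ.intPoint (le_refl (level θ n)))) = t := by
  have h := congrArg φ (hθ.aeval_intPoint_eq_zero (le_refl (level θ n)))
  rw [map_aeval_int, map_zero, map_sub, Chebyshev.aeval_C, sub_eq_zero] at h
  simpa using h

theorem IsCompatible.ringHom_ringInclusion_ext (hθ : IsCompatible ℓ t θ)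
    (hirr : ∀ n : ℕ, 1 ≤ n → Irreducible (chebIter ℓ ℤ n - Polynomial.C t))
    (hp : ¬ (p : ℤ) ∣ (ℓ : ℤ) * (4 - t ^ 2)) {m n : ℕ} (h : level θ m ≤ level θ n)
    (φ : 𝓞 (level θ m) →+* κ) (ψ : 𝓞 (level θ n) →+* κ)
    (hψ : ψ (ringInclusion h (hθ.intPoint (le_refl (level θ m)))) =
      φ (hθ.intPoint (le_refl (level θ m)))) : ψ.comp (ringInclusion h) = φ :=
  hθ.ringHom_level_ext hirr hp hψ

variable [IsAlgClosed κ]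

/-- A homomorphism `φ` from a base ring to a field of characteristic `p`, such that the points of
`K_n` over it have as many conjugates as their degree over the base, has a kernel which stays
prime in the ring of integers of `K_n`. -/
theorem IsCompatible.isPrime_map_ker (hθ : IsCompatible ℓ t θ)
    (hirr : ∀ n : ℕ, 1 ≤ n → Irreducible (chebIter ℓ ℤ n - Polynomial.C t))
    (hp : ¬ (p : ℤ) ∣ (ℓ : ℤ) * (4 - t ^ 2)) {n N : ℕ} (hN : 0 < N) {R : Type*} [CommRing R]
    {ι : R →+* 𝓞 (level θ n)} {φ : R →+* κ} {s : R}
    (hs : aeval (hθ.intPoint (le_refl (level θ n))) (Chebyshev.C ℤ (N : ℤ)) = ι s)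
    (hNs : ∀ b : κ, (Chebyshev.C κ (N : ℤ)).eval b = φ s →
      (Chebyshev.C κ ((ℓ ^ n : ℕ) : ℤ)).eval b = t)
    (hext : ∀ ψ : 𝓞 (level θ n) →+* κ, ψ (ι s) = φ s → ψ.comp ι = φ)
    {r : ℕ} (hfix : ∀ x, φ x ^ p ^ r = φ x)
    (hconj : ∀ b : κ, (Chebyshev.C κ ((ℓ ^ n : ℕ) : ℤ)).eval b = t →
      ∀ k, 0 < k → k < N → b ^ (p ^ r) ^ k ≠ b) :
    ((RingHom.ker φ).map ι).IsPrime := by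
  have : Nontrivial R := φ.domain_nontrivial
  obtain ⟨b, hb⟩ := exists_chebyshev_eq hN (φ s)
  obtain ⟨ψ, hψ⟩ := hθ.exists_ringHom_level hirr hp n (hNs b hb)
  have hψs : ψ (ι s) = φ s := by
    rw [← hs, map_aeval_int, hψ, Chebyshev.aeval_C, hb]
  have hpI : (p : R) ∈ RingHom.ker φ := by
    rw [RingHom.mem_ker, map_natCast, CharP.cast_eq_zero]
  rw [map_ker_eq_ker (chebyshev_sub_C_monic hN s) ?_
    ((hθ.isGeneratedPrimeTo_level hirr Fact.out hp n).exists_sub_eval₂_mem Fact.out ι hpI)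
    (hext ψ hψs) ?_]
  · exact RingHom.ker_isPrime ψ
  · rw [eval₂_sub, eval₂_C, ← hs, ← eval_map, Chebyshev.map_C, Chebyshev.aeval_C, sub_self]
  · intro h hlt h0
    rw [degree_eq_natDegree (chebyshev_sub_C_monic hN s).ne_zero,
      chebyshev_sub_C_natDegree hN] at hlt
    rw [hψ] at h0
    refine eq_zero_of_conjugates (p := p) (degree_map_le.trans_lt hlt) (fun i ↦ ?_) h0
      (hconj b (hNs b hb))
    rw [coeff_map, hfix]

theorem IsCompatible.isProdDistinctPrimes_map_ker (hθ : IsCompatible ℓ t θ)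
    (hirr : ∀ n : ℕ, 1 ≤ n → Irreducible (chebIter ℓ ℤ n - Polynomial.C t))
    (hp : ¬ (p : ℤ) ∣ (ℓ : ℤ) * (4 - t ^ 2)) {n N : ℕ} (hN : 0 < N) (hN0 : (N : κ) ≠ 0)
    {R : Type*} [CommRing R]
    {ι : R →+* 𝓞 (level θ n)} {φ : R →+* κ} (hmax : (RingHom.ker φ).IsMaximal) {s : R}
    (hs4 : φ s ^ 2 ≠ 4)
    (hs : aeval (hθ.intPoint (le_refl (level θ n))) (Chebyshev.C ℤ (N : ℤ)) = ι s)
    (hNs : ∀ b : κ, (Chebyshev.C κ (N : ℤ)).eval b = φ s →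
      (Chebyshev.C κ ((ℓ ^ n : ℕ) : ℤ)).eval b = t)
    (hext : ∀ ψ : 𝓞 (level θ n) →+* κ, ψ (ι s) = φ s → ψ.comp ι = φ)
    (hrange : ∀ b : κ, (Chebyshev.C κ ((ℓ ^ n : ℕ) : ℤ)).eval b = t → b ∈ φ.range) :
    IsProdDistinctPrimes ((RingHom.ker φ).map ι) N := by
  have : Nontrivial R := φ.domain_nontrivial
  have hpI : (p : R) ∈ RingHom.ker φ := by
    rw [RingHom.mem_ker, map_natCast, CharP.cast_eq_zero]
  obtain ⟨S, hS, hSb⟩ := exists_finset_chebyshev_eq hN0 hs4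
  have key := ChebTower.isProdDistinctPrimes_map_ker (φ := φ) (chebyshev_sub_C_monic hN s)
    (by rw [eval₂_sub, eval₂_C, ← hs, ← eval_map, Chebyshev.map_C, Chebyshev.aeval_C, sub_self])
    ((hθ.isGeneratedPrimeTo_level hirr Fact.out hp n).exists_sub_eval₂_mem Fact.out ι hpI)
    (by rwa [chebyshev_sub_C_natDegree hN]) (fun r hr ↦ ?_) S
    (by rw [hS, chebyshev_sub_C_natDegree hN]) (fun b hb ↦ hrange b (hNs b (hSb b hb)))
    (fun b hb ↦ ?_)
  · rwa [chebyshev_sub_C_natDegree hN] at key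
  · obtain ⟨y, i, hi, hy⟩ := hmax.exists_inv (x := r) hr
    refine ⟨y, ?_⟩
    have := congrArg φ hy
    rwa [map_add, (RingHom.mem_ker).mp hi, add_zero, map_one] at this
  · obtain ⟨ψ, hψ⟩ := hθ.exists_ringHom_level hirr hp n (hNs b (hSb b hb))
    refine ⟨ψ, hext ψ ?_, hψ⟩
    rw [← hs, map_aeval_int, hψ, Chebyshev.aeval_C, hSb b hb]

/-- Homomorphisms from `𝓞 K_m` are determined by the image of `θ m`, so `hfix` makes the `p ^
r`-power map trivial on their images. The points above then have as many conjugates over the base as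
the relative degree. -/
theorem IsCompatible.inertAbove (hθ : IsCompatible ℓ t θ)
    (hirr : ∀ n : ℕ, 1 ≤ n → Irreducible (chebIter ℓ ℤ n - Polynomial.C t))
    (hp : ¬ (p : ℤ) ∣ (ℓ : ℤ) * (4 - t ^ 2)) {m n r : ℕ} (hmn : m ≤ n)
    (hfix : ∀ b : κ, (Chebyshev.C κ ((ℓ ^ m : ℕ) : ℤ)).eval b = t → b ^ p ^ r = b)
    (hconj : ∀ b : κ, (Chebyshev.C κ ((ℓ ^ n : ℕ) : ℤ)).eval b = t →
      ∀ k, 0 < k → k < ℓ ^ (n - m) → b ^ (p ^ r) ^ k ≠ b) :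
    InertAbove p (level θ m) (level θ n) := by
  refine ⟨hθ.level_mono hmn, fun P hP hpP ↦ ?_⟩
  obtain ⟨φ, rfl⟩ := exists_ringHom_ker_eq (κ := κ) P hpP
  refine hθ.isPrime_map_ker hirr hp (ell_pow_pos (n - m))
    (s := hθ.intPoint (le_refl (level θ m))) (r := r) ?_ (fun b hb ↦ ?_) (fun ψ hψ ↦ ?_)
    (fun x ↦ ?_) hconj
  · exact hθ.eval_intPoint hmn (hθ.level_mono hmn) le_rfl
  · exact eval_chebyshev_trans hmn hb (hθ.eval_ringHom_level φ)
  · exact hθ.ringHom_ringInclusion_ext hirr hp _ φ ψ hψ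
  · have : (iterateFrobenius κ p r).comp φ = φ :=
      hθ.ringHom_level_ext hirr hp (hfix _ (hθ.eval_ringHom_level φ))
    exact RingHom.congr_fun this x

theorem IsCompatible.inert (hθ : IsCompatible ℓ t θ)
    (hirr : ∀ n : ℕ, 1 ≤ n → Irreducible (chebIter ℓ ℤ n - Polynomial.C t))
    (hp : ¬ (p : ℤ) ∣ (ℓ : ℤ) * (4 - t ^ 2)) {n : ℕ}
    (hconj : ∀ b : κ, (Chebyshev.C κ ((ℓ ^ n : ℕ) : ℤ)).eval b = t →
      ∀ k, 0 < k → k < ℓ ^ n → b ^ p ^ k ≠ b) :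
    Inert p (level θ n) := by
  have h := hθ.isPrime_map_ker hirr hp (ell_pow_pos n) (ι := Int.castRingHom _)
    (φ := Int.castRingHom κ) (s := t) (r := 1) ?_ (fun b hb ↦ by simpa using hb)
    (fun ψ _ ↦ RingHom.ext_int _ _) (fun x ↦ ?_) (by simpa using hconj)
  · rw [intCast_ker (p := p), Ideal.map_span, Set.image_singleton] at h
    simpa [Inert] using h
  · simpa [sub_eq_zero] using hθ.aeval_intPoint_eq_zero (le_refl (level θ n))
  · have : (iterateFrobenius κ p 1).comp (Int.castRingHom κ) = Int.castRingHom κ :=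
      RingHom.ext_int _ _
    exact RingHom.congr_fun this x

theorem IsCompatible.splitsCompletely (hθ : IsCompatible ℓ t θ)
    (hirr : ∀ n : ℕ, 1 ≤ n → Irreducible (chebIter ℓ ℤ n - Polynomial.C t))
    (hp : ¬ (p : ℤ) ∣ (ℓ : ℤ) * (4 - t ^ 2)) {n : ℕ}
    (hfix : ∀ b : κ, (Chebyshev.C κ ((ℓ ^ n : ℕ) : ℤ)).eval b = t → b ^ p = b) :
    SplitsCompletely p (level θ n) := by
  have h := hθ.isProdDistinctPrimes_map_ker hirr hp (ell_pow_pos n)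
    (ell_pow_ne_zero_of_not_dvd (κ := κ) hp n) (ι := Int.castRingHom _)
    (φ := Int.castRingHom κ)
    (by rw [intCast_ker (p := p)]; exact Int.ideal_span_isMaximal_of_prime p)
    (s := t) (sq_ne_four_of_not_dvd hp) ?_ (fun b hb ↦ by simpa using hb)
    (fun ψ _ ↦ RingHom.ext_int _ _) (fun b hb ↦ mem_range_intCast_of_pow_eq (hfix b hb))
  · rw [intCast_ker (p := p), Ideal.map_span, Set.image_singleton] at h
    rw [SplitsCompletely, hθ.finrank_level hirr]
    simpa using h
  · simpa [sub_eq_zero] using hθ.aeval_intPoint_eq_zero (le_refl (level θ n))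

theorem IsCompatible.relfinrank_level (hθ : IsCompatible ℓ t θ)
    (hirr : ∀ n : ℕ, 1 ≤ n → Irreducible (chebIter ℓ ℤ n - Polynomial.C t)) {m n : ℕ}
    (hmn : m ≤ n) : IntermediateField.relfinrank (level θ m) (level θ n) = ℓ ^ (n - m) := by
  have h := IntermediateField.finrank_bot_mul_relfinrank (hθ.level_mono hmn)
  rw [hθ.finrank_level hirr, hθ.finrank_level hirr] at h
  refine Nat.eq_of_mul_eq_mul_left (ell_pow_pos (ℓ := ℓ) m) ?_
  rw [h, ← pow_add, Nat.add_sub_cancel' hmn]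

/-- The two base hypotheses say that the residue fields of `K_m` are exactly `𝔽_{p²}`; by `hfix` all
points above already lie there. -/
theorem IsCompatible.splitsCompletelyAbove (hθ : IsCompatible ℓ t θ)
    (hirr : ∀ n : ℕ, 1 ≤ n → Irreducible (chebIter ℓ ℤ n - Polynomial.C t))
    (hp : ¬ (p : ℤ) ∣ (ℓ : ℤ) * (4 - t ^ 2)) {m n : ℕ} (hmn : m ≤ n)
    (hbase : ∀ b : κ, (Chebyshev.C κ ((ℓ ^ m : ℕ) : ℤ)).eval b = t → b ^ p ≠ b)
    (hbase' : ∀ b : κ, (Chebyshev.C κ ((ℓ ^ m : ℕ) : ℤ)).eval b = t → b ^ p ^ 2 = b)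
    (hfix : ∀ b : κ, (Chebyshev.C κ ((ℓ ^ n : ℕ) : ℤ)).eval b = t → b ^ p ^ 2 = b) :
    SplitsCompletelyAbove p (level θ m) (level θ n) := by
  refine ⟨hθ.level_mono hmn, fun P hP hpP ↦ ?_⟩
  obtain ⟨φ, rfl⟩ := exists_ringHom_ker_eq (κ := κ) P hpP
  rw [hθ.relfinrank_level hirr hmn]
  have hfixφ : ∀ x, φ x ^ p ^ 2 = φ x := by
    intro x
    have : (iterateFrobenius κ p 2).comp φ = φ :=
      hθ.ringHom_level_ext hirr hp (hbase' _ (hθ.eval_ringHom_level φ))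
    exact RingHom.congr_fun this x
  refine hθ.isProdDistinctPrimes_map_ker hirr hp (ell_pow_pos (n - m))
    (ell_pow_ne_zero_of_not_dvd (κ := κ) hp (n - m)) (isMaximal_of_mem _ hpP)
    (s := hθ.intPoint (le_refl (level θ m))) ?_ ?_ (fun b hb ↦ ?_) (fun ψ hψ ↦ ?_)
    (fun b hb ↦ ?_)
  · exact sq_ne_four_of_chebyshev (hθ.eval_ringHom_level φ) (sq_ne_four_of_not_dvd hp)
  · exact hθ.eval_intPoint hmn (hθ.level_mono hmn) le_rfl
  · exact eval_chebyshev_trans hmn hb (hθ.eval_ringHom_level φ)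
  · exact hθ.ringHom_ringInclusion_ext hirr hp _ φ ψ hψ
  · exact mem_range_of_pow_sq_eq φ hfixφ (hbase _ (hθ.eval_ringHom_level φ)) (hfix b hb)

end Tower

/-- Since `1` and `-1` differ modulo `ℓ ^ w ≥ 3`, divisibility forces `δ = e ^ k`. Lifting the
exponent gives `q ^ k - e ^ k` the valuation of `k` plus `w`, and `k < ℓ ^ m` keeps this below `w +
m`. -/
theorem not_pow_dvd_pow_sub {ℓ w m k : ℕ} [Fact ℓ.Prime] {q e δ : ℤ} (he : e = 1 ∨ e = -1)
    (hδ : δ = 1 ∨ δ = -1) (h3 : 3 ≤ ℓ ^ w) (hw : (ℓ : ℤ) ^ w ∣ q - e)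
    (hw' : ¬ (ℓ : ℤ) ^ (w + 1) ∣ q - e) (hk : 0 < k) (hkm : k < ℓ ^ m) :
    ¬ (ℓ : ℤ) ^ (w + m) ∣ q ^ k - δ := by
  intro h
  have hℓ : ℓ.Prime := Fact.out
  have hw0 : w ≠ 0 := by rintro rfl; simp at h3
  have hek : e ^ k = 1 ∨ e ^ k = -1 := by
    rcases he with rfl | rfl
    · simp
    · exact neg_one_pow_eq_or ℤ k
  have h1 : (ℓ : ℤ) ^ w ∣ q ^ k - e ^ k := hw.trans (sub_dvd_pow_sub_pow q e k)
  have h2 : (ℓ : ℤ) ^ w ∣ e ^ k - δ := by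
    have := dvd_sub ((pow_dvd_pow _ (Nat.le_add_right w m)).trans h) h1
    simpa using this
  have h3' : (3 : ℤ) ≤ (ℓ : ℤ) ^ w := by exact_mod_cast h3
  have heq : e ^ k = δ := by
    rcases hek with h | h <;> rcases hδ with h' | h' <;> rw [h, h'] at h2 ⊢
    · exact absurd (Int.le_of_dvd (by norm_num) h2) (by norm_num; omega)
    · rw [← dvd_neg] at h2
      exact absurd (Int.le_of_dvd (by norm_num) h2) (by norm_num; omega)
  have hℓq : (ℓ : ℤ) ∣ q - e := (dvd_pow_self _ hw0).trans hw
  have hnq : ¬ (ℓ : ℤ) ∣ q := by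
    intro hq
    have h4 : (ℓ : ℤ) ∣ e := by simpa using dvd_sub hq hℓq
    have h5 : IsUnit (ℓ : ℤ) := isUnit_of_dvd_unit h4 (by rcases he with rfl | rfl <;> simp)
    exact (Nat.prime_iff_prime_int.mp hℓ).not_isUnit h5
  have hmul : emultiplicity (ℓ : ℤ) (q ^ k - e ^ k) =
      emultiplicity (ℓ : ℤ) (q - e) + emultiplicity (ℓ : ℤ) (k : ℤ) := by
    rcases hℓ.eq_two_or_odd' with rfl | hodd
    -- At the prime `2` the additive formula needs `4 ∣ q - e`, which is what `3 ≤ 2 ^ w` supplies.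
    · have hw2 : 2 ≤ w := by
        by_contra hlt
        have : w = 1 := by omega
        subst this
        norm_num at h3
      exact Int.two_pow_sub_pow' k (by simpa using (pow_dvd_pow (2 : ℤ) hw2).trans hw) hnq
    · rw [Int.emultiplicity_pow_sub_pow hℓ hodd hℓq hnq, Int.natCast_emultiplicity]
  rw [emultiplicity_eq_coe.mpr ⟨hw, hw'⟩] at hmul
  rw [← heq, pow_dvd_iff_le_emultiplicity, hmul, Nat.cast_add,
    ENat.add_le_add_iff_left (ENat.natCast_ne_top w), ← pow_dvd_iff_le_emultiplicity] at h
  have h6 : ℓ ^ m ∣ k := by exact_mod_cast h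
  exact absurd (Nat.le_of_dvd hk h6) (by omega)

/-! ### Frobenius orbits of points through orders of units. -/

section Field

variable {κ : Type*} [Field κ]

theorem pow_add_inv_eq_iff (u : κˣ) (m n : ℕ) :
    (u : κ) ^ m + ((u : κ) ^ m)⁻¹ = (u : κ) ^ n + ((u : κ) ^ n)⁻¹ ↔
      ∃ e : ℤ, (e = 1 ∨ e = -1) ∧ (orderOf u : ℤ) ∣ m - e * n := by
  rw [add_inv_eq_add_inv_iff (pow_ne_zero _ u.ne_zero) (pow_ne_zero _ u.ne_zero)]
  have h1 : (u : κ) ^ m = (u : κ) ^ n ↔ (orderOf u : ℤ) ∣ m - 1 * n := by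
    rw [orderOf_dvd_iff_zpow_eq_one, one_mul, zpow_sub, zpow_natCast, zpow_natCast,
      mul_inv_eq_one, Units.ext_iff]
    simp
  have h2 : (u : κ) ^ m = ((u : κ) ^ n)⁻¹ ↔ (orderOf u : ℤ) ∣ m - (-1) * n := by
    rw [orderOf_dvd_iff_zpow_eq_one, neg_one_mul, sub_neg_eq_add, zpow_add, zpow_natCast,
      zpow_natCast, mul_eq_one_iff_eq_inv, Units.ext_iff]
    simp
  rw [h1, h2]
  constructor
  · rintro (h | h)
    · exact ⟨1, Or.inl rfl, h⟩
    · exact ⟨-1, Or.inr rfl, h⟩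
  · rintro ⟨e, rfl | rfl, h⟩
    · exact Or.inl h
    · exact Or.inr h

theorem frobenius_fixed_iff {p : ℕ} [Fact p.Prime] [CharP κ p] (u : κˣ) (r : ℕ) :
    ((u : κ) + (u : κ)⁻¹) ^ p ^ r = (u : κ) + (u : κ)⁻¹ ↔
      ∃ e : ℤ, (e = 1 ∨ e = -1) ∧ (orderOf u : ℤ) ∣ (p : ℤ) ^ r - e := by
  rw [add_pow_char_pow, inv_pow]
  have := pow_add_inv_eq_iff u (p ^ r) 1
  simpa using this

theorem exists_pow_eq_of_chebyshev_eq [IsAlgClosed κ] {N : ℕ} {α : κˣ} {a b : κ}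
    (hα : (α : κ) + (α : κ)⁻¹ = a) (hb : (Chebyshev.C κ (N : ℤ)).eval b = a) :
    ∃ γ : κˣ, (γ : κ) + (γ : κ)⁻¹ = b ∧ γ ^ N = α := by
  obtain ⟨z, hz, rfl⟩ := exists_add_inv_eq b
  rw [chebyshev_eval_add_inv hz, ← hα,
    add_inv_eq_add_inv_iff (pow_ne_zero _ hz) α.ne_zero] at hb
  rcases hb with h | h
  · exact ⟨Units.mk0 z hz, rfl, Units.ext (by simpa using h)⟩
  · refine ⟨(Units.mk0 z hz)⁻¹, by simp [add_comm], Units.ext ?_⟩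
    simp [h]

/-- Once `ℓ` divides the order, each extraction of an `ℓ`-th root multiplies the order by exactly
`ℓ`. This makes all points over `t` behave alike when `ρ > 0`. -/
theorem orderOf_eq_of_pow_eq {G : Type*} [Group G] {ℓ : ℕ} (hℓ : ℓ ≠ 0) {n : ℕ} {α γ : G}
    (h : γ ^ ℓ ^ n = α) (hα : ℓ ∣ orderOf α) : orderOf γ = ℓ ^ n * orderOf α := by
  induction n generalizing γ with
  | zero => simp_all
  | succ n ih =>
    have h1 := ih (γ := γ ^ ℓ) (by rw [← pow_mul, ← pow_succ', h])
    have h2 : ℓ ∣ orderOf γ := (hα.trans (h1 ▸ Dvd.intro_left _ rfl)).trans (orderOf_pow_dvd ℓ)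
    rw [orderOf_pow_of_dvd hℓ h2] at h1
    rw [← Nat.mul_div_cancel' h2, h1]
    ring

section Levels

variable [IsAlgClosed κ] {ℓ p ρ d : ℕ} [Fact ℓ.Prime] [Fact p.Prime] [CharP κ p] {α : κˣ} {a : κ}

theorem frobenius_fixed_of_level (hα : (α : κ) + (α : κ)⁻¹ = a) (hρ : 0 < ρ)
    (hord : orderOf α = ℓ ^ ρ * d) (hd : ¬ ℓ ∣ d) {r w n : ℕ} {e : ℤ} (he : e = 1 ∨ e = -1)
    (hw : (ℓ : ℤ) ^ w ∣ (p : ℤ) ^ r - e) (hdq : (d : ℤ) ∣ (p : ℤ) ^ r - e) (hn : n + ρ ≤ w)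
    {b : κ} (hb : (Chebyshev.C κ ((ℓ ^ n : ℕ) : ℤ)).eval b = a) : b ^ p ^ r = b := by
  have hℓ : ℓ.Prime := Fact.out
  obtain ⟨γ, rfl, hγ⟩ := exists_pow_eq_of_chebyshev_eq hα hb
  have hordγ := orderOf_eq_of_pow_eq hℓ.ne_zero hγ
    (hord ▸ Dvd.dvd.mul_right (dvd_pow_self ℓ hρ.ne') d)
  rw [frobenius_fixed_iff]
  refine ⟨e, he, ?_⟩
  rw [hordγ, hord, ← mul_assoc, ← pow_add]
  push_cast
  refine IsCoprime.mul_dvd ?_ ((pow_dvd_pow _ hn).trans hw) hdq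
  exact_mod_cast (Nat.isCoprime_iff_coprime.mpr
    (((hℓ.coprime_iff_not_dvd).mpr hd).pow_left (n + ρ)))

/-- The roots `γ` have order `ℓ ^ (w + m) * d`, and lifting the exponent keeps `ℓ ^ (w + m)` from
dividing `p ^ (r k) ± 1` for `0 < k < ℓ ^ m`. -/
theorem frobenius_ne_of_level (hα : (α : κ) + (α : κ)⁻¹ = a) (hρ : 0 < ρ)
    (hord : orderOf α = ℓ ^ ρ * d) {r w n m : ℕ} {e : ℤ} (he : e = 1 ∨ e = -1)
    (h3 : 3 ≤ ℓ ^ w) (hw : (ℓ : ℤ) ^ w ∣ (p : ℤ) ^ r - e)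
    (hw' : ¬ (ℓ : ℤ) ^ (w + 1) ∣ (p : ℤ) ^ r - e) (hn : w + m = n + ρ)
    {b : κ} (hb : (Chebyshev.C κ ((ℓ ^ n : ℕ) : ℤ)).eval b = a) {k : ℕ} (hk : 0 < k)
    (hkm : k < ℓ ^ m) : b ^ (p ^ r) ^ k ≠ b := by
  have hℓ : ℓ.Prime := Fact.out
  obtain ⟨γ, rfl, hγ⟩ := exists_pow_eq_of_chebyshev_eq hα hb
  have hordγ := orderOf_eq_of_pow_eq hℓ.ne_zero hγ
    (hord ▸ Dvd.dvd.mul_right (dvd_pow_self ℓ hρ.ne') d)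
  rw [← pow_mul, Ne, frobenius_fixed_iff]
  rintro ⟨δ, hδ, h⟩
  rw [hordγ, hord, ← mul_assoc, ← pow_add, ← hn, pow_mul] at h
  push_cast at h
  exact not_pow_dvd_pow_sub he hδ h3 hw hw' hk hkm ((Dvd.intro _ rfl).trans h)

end Levels

end Field

/-! ### Preperiod and cycle as the `ℓ`-part and prime-to-`ℓ` part of an order. -/

section Preperiod

variable {ℓ p : ℕ} [Fact p.Prime] {t : ℤ} {κ : Type*} [Field κ] [CharP κ p] {α : κˣ}

theorem castHom_iterate_chebMap (hα : (α : κ) + (α : κ)⁻¹ = t) (n : ℕ) :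
    ZMod.castHom (dvd_refl p) κ ((chebMap ℓ (ZMod p))^[n] (t : ZMod p)) =
      (α : κ) ^ ℓ ^ n + ((α : κ) ^ ℓ ^ n)⁻¹ := by
  rw [chebMap_iterate, ← chebyshev_eval_add_inv α.ne_zero, hα,
    ← Chebyshev.map_C (ZMod.castHom (dvd_refl p) κ), eval_map,
    ← map_intCast (ZMod.castHom (dvd_refl p) κ), eval₂_at_apply]

theorem iterate_chebMap_eq_iff (hα : (α : κ) + (α : κ)⁻¹ = t) (r s : ℕ) :
    (chebMap ℓ (ZMod p))^[r + s] (t : ZMod p) = (chebMap ℓ (ZMod p))^[r] (t : ZMod p) ↔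
      ∃ e : ℤ, (e = 1 ∨ e = -1) ∧ (orderOf α : ℤ) ∣ (ℓ : ℤ) ^ r * ((ℓ : ℤ) ^ s - e) := by
  rw [← (ZMod.castHom (dvd_refl p) κ).injective.eq_iff, castHom_iterate_chebMap hα,
    castHom_iterate_chebMap hα, pow_add_inv_eq_iff]
  have : ∀ e : ℤ, ((ℓ ^ (r + s) : ℕ) : ℤ) - e * ((ℓ ^ r : ℕ) : ℤ) =
      (ℓ : ℤ) ^ r * ((ℓ : ℤ) ^ s - e) := by
    intro e
    push_cast
    ring
  simp_rw [this]

variable [Fact ℓ.Prime]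

/-- The condition is `ℓ ^ j * d ∣ ℓ ^ r (ℓ ^ s - e)`. As `ℓ ∤ ℓ ^ s - e`, the `ℓ`-part needs `j ≤
r`; Euler's theorem with `s = φ(d)` handles `d`. -/
theorem exists_iterate_eq_iff_le (hα : (α : κ) + (α : κ)⁻¹ = t) {j d : ℕ}
    (hord : orderOf α = ℓ ^ j * d) (hd : ¬ ℓ ∣ d) (r : ℕ) :
    (∃ s, 1 ≤ s ∧ (chebMap ℓ (ZMod p))^[r + s] (t : ZMod p) =
      (chebMap ℓ (ZMod p))^[r] (t : ZMod p)) ↔ j ≤ r := by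
  have hℓ : ℓ.Prime := Fact.out
  have hℓ' : Prime (ℓ : ℤ) := Nat.prime_iff_prime_int.mp hℓ
  simp_rw [iterate_chebMap_eq_iff hα, hord]
  push_cast
  constructor
  · rintro ⟨s, hs, e, he, h⟩
    have h1 : ¬ (ℓ : ℤ) ∣ (ℓ : ℤ) ^ s - e := by
      intro h2
      have h3 : (ℓ : ℤ) ∣ e := by
        have := dvd_sub (dvd_pow_self (ℓ : ℤ) (by omega : s ≠ 0)) h2
        simpa using this
      exact hℓ'.not_isUnit (isUnit_of_dvd_unit h3 (by rcases he with rfl | rfl <;> simp))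
    have h2 : (ℓ : ℤ) ^ j ∣ (ℓ : ℤ) ^ r :=
      ((hℓ'.coprime_iff_not_dvd.mpr h1).pow_left).dvd_of_dvd_mul_right
        ((Dvd.intro _ rfl).trans h)
    exact (pow_dvd_pow_iff hℓ'.ne_zero hℓ'.not_isUnit).mp h2
  · intro hjr
    have hd0 : 0 < d := Nat.pos_of_ne_zero (by rintro rfl; simp at hd)
    refine ⟨d.totient, Nat.totient_pos.mpr hd0, 1, Or.inl rfl, mul_dvd_mul (pow_dvd_pow _ hjr) ?_⟩
    have h1 := (Nat.ModEq.pow_totient ((hℓ.coprime_iff_not_dvd).mpr hd)).symm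
    have h2 := (Nat.modEq_iff_dvd.mp h1)
    simpa using h2

theorem preperiod_eq (hα : (α : κ) + (α : κ)⁻¹ = t) {j d : ℕ}
    (hord : orderOf α = ℓ ^ j * d) (hd : ¬ ℓ ∣ d) :
    preperiod (chebMap ℓ (ZMod p)) (t : ZMod p) = j := by
  unfold preperiod
  simp_rw [exists_iterate_eq_iff_le hα hord hd]
  exact csInf_Ici

variable (ℓ p t κ) in
-- The sign `e` arises because `t` is fixed by Frobenius, so `α ^ p` is `α` or `α⁻¹`.
theorem exists_unit_add_inv_eq [IsAlgClosed κ] : ∃ (α : κˣ) (d : ℕ) (e : ℤ),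
    (α : κ) + (α : κ)⁻¹ = t ∧ ¬ ℓ ∣ d ∧
      orderOf α = ℓ ^ preperiod (chebMap ℓ (ZMod p)) (t : ZMod p) * d ∧
      (e = 1 ∨ e = -1) ∧ (orderOf α : ℤ) ∣ p - e := by
  have hℓ : ℓ.Prime := Fact.out
  obtain ⟨z, hz, hzt⟩ := exists_add_inv_eq (t : κ)
  set α := Units.mk0 z hz
  have hα : (α : κ) + (α : κ)⁻¹ = t := hzt
  have hfix : ((α : κ) + (α : κ)⁻¹) ^ p ^ 1 = (α : κ) + (α : κ)⁻¹ := by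
    rw [hα]
    exact RingHom.congr_fun (RingHom.ext_int ((iterateFrobenius κ p 1).comp (Int.castRingHom κ))
      (Int.castRingHom κ)) t
  obtain ⟨e, he, hdvd⟩ := (frobenius_fixed_iff α 1).mp hfix
  rw [pow_one] at hdvd
  have h0 : orderOf α ≠ 0 := by
    intro h0
    rw [h0, Nat.cast_zero, zero_dvd_iff] at hdvd
    have := (Fact.out : p.Prime).two_le
    rcases he with rfl | rfl <;> omega
  obtain ⟨j, d, hd, hord⟩ := Nat.exists_eq_pow_mul_and_not_dvd h0 ℓ hℓ.ne_one
  exact ⟨α, d, e, hα, hd, by rw [preperiod_eq hα hord hd, hord], he, hdvd⟩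

/-- At a periodic iterate the `ℓ`-part of the order is exhausted, so `α ^ ℓ ^ k` has order `d`. The
only other unit with the same trace is its inverse, of equal order. -/
theorem eq_of_connectedToCycle [IsAlgClosed κ] (hα : (α : κ) + (α : κ)⁻¹ = t) {j d d' : ℕ}
    (hord : orderOf α = ℓ ^ j * d) (hd : ¬ ℓ ∣ d)
    (h : ConnectedToCycle ℓ p (t : ZMod p) d') : d' = d := by
  have hℓ : ℓ.Prime := Fact.out
  obtain ⟨k, ⟨s, hs, hper⟩, β, hβ, rfl⟩ := h
  have hjk : j ≤ k := by
    refine (exists_iterate_eq_iff_le (ℓ := ℓ) (p := p) hα hord hd k).mp ⟨s, hs, ?_⟩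
    rw [add_comm, Function.iterate_add_apply]
    exact hper
  let := ZMod.algebra κ p
  let f : GaloisField p 2 →ₐ[ZMod p] κ := IsAlgClosed.lift
  set u : κˣ := Units.map (f : GaloisField p 2 →* κ) β with hu
  have hordu : orderOf u = orderOf β :=
    orderOf_injective _ (Units.map_injective f.toRingHom.injective) β
  have hsum : (u : κ) + (u : κ)⁻¹ = (α : κ) ^ ℓ ^ k + ((α : κ) ^ ℓ ^ k)⁻¹ := by
    rw [← castHom_iterate_chebMap (p := p) hα]
    have h1 := congrArg f hβ
    rw [AlgHom.commutes, map_add] at h1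
    have h2 : algebraMap (ZMod p) κ = ZMod.castHom (dvd_refl p) κ := RingHom.ext_zmod _ _
    rw [← h2, h1]
    simp [hu]
  have hordα : orderOf (α ^ ℓ ^ k) = d := by
    rw [← Nat.add_sub_cancel' hjk, pow_add, pow_mul]
    have h1 : orderOf (α ^ ℓ ^ j) = d := by
      rw [orderOf_pow_of_dvd (pow_ne_zero _ hℓ.ne_zero) (hord ▸ Dvd.intro _ rfl), hord,
        Nat.mul_div_cancel_left _ (pow_pos hℓ.pos _)]
    rw [Nat.Coprime.orderOf_pow, h1]
    rw [h1]
    exact (((hℓ.coprime_iff_not_dvd).mpr hd).pow_left _).symm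
  rw [add_inv_eq_add_inv_iff u.ne_zero (pow_ne_zero _ α.ne_zero)] at hsum
  rw [← hordu, ← hordα]
  rcases hsum with h | h
  · rw [show u = α ^ ℓ ^ k from Units.ext (by simpa using h)]
  · rw [show u = (α ^ ℓ ^ k)⁻¹ from Units.ext (by simpa using h), orderOf_inv]

end Preperiod

theorem mem_periodicPts_of_backward_orbit {S : Type*} [Finite S] {T : S → S} {b : ℕ → S}
    (hb : ∀ n, T (b (n + 1)) = b n) (n : ℕ) : b n ∈ Function.periodicPts T := by
  have hiter : ∀ m k, T^[k] (b (m + k)) = b m := by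
    intro m k
    induction k with
    | zero => rfl
    | succ k ih => rw [Function.iterate_succ_apply, ← add_assoc, hb, ih]
  -- A repetition makes the later entry periodic, and forward iteration carries periodicity down to
  -- `b n`.
  have key : ∀ i j, i < j → b (n + i) = b (n + j) → b n ∈ Function.periodicPts T := by
    intro i j hij heq
    have h1 : b (n + j) ∈ Function.periodicPts T := by
      refine ⟨j - i, Nat.sub_pos_of_lt hij, ?_⟩
      have := hiter (n + i) (j - i)
      rwa [show n + i + (j - i) = n + j by omega, heq] at this
    rw [← hiter n j]
    exact (Function.bijOn_periodicPts T).mapsTo.iterate j h1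
  obtain ⟨i, j, hne, heq⟩ := Finite.exists_ne_map_eq_of_infinite fun i ↦ b (n + i)
  rcases lt_or_gt_of_ne hne with h | h
  · exact key i j h heq
  · exact key j i h heq.symm

theorem backward_orbit_unique {S : Type*} [Finite S] {T : S → S} {b b' : ℕ → S}
    (hb : ∀ n, T (b (n + 1)) = b n) (hb' : ∀ n, T (b' (n + 1)) = b' n) (h0 : b 0 = b' 0) (n : ℕ) :
    b n = b' n := by
  induction n with
  | zero => exact h0
  | succ n ih =>
    refine (Function.bijOn_periodicPts T).injOn (mem_periodicPts_of_backward_orbit hb _)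
      (mem_periodicPts_of_backward_orbit hb' _) ?_
    rw [hb, hb', ih]

theorem exists_backward_orbit {S : Type*} {T : S → S} {a : S} (ha : a ∈ Function.periodicPts T) :
    ∃ b : ℕ → S, b 0 = a ∧ ∀ n, T (b (n + 1)) = b n := by
  have hsurj : ∀ x : Function.periodicPts T, ∃ y : Function.periodicPts T, T y = x := by
    rintro ⟨x, hx⟩
    obtain ⟨y, hy, h⟩ := (Function.bijOn_periodicPts T).surjOn hx
    exact ⟨⟨y, hy⟩, h⟩
  choose g hg using hsurj
  refine ⟨fun n ↦ (g^[n] ⟨a, ha⟩ : Function.periodicPts T), rfl, fun n ↦ ?_⟩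
  change T (g^[n + 1] ⟨a, ha⟩ : Function.periodicPts T) = (g^[n] ⟨a, ha⟩ : Function.periodicPts T)
  rw [Function.iterate_succ_apply', hg]

/-! ### Degree one primes as kernels of homomorphisms to `𝔽_p`. -/

section DegreeOne

variable {p : ℕ} [Fact p.Prime] {L : Type*} [Field L] [CharZero L] {F : IntermediateField ℚ L}

theorem isDegreeOnePrime_ker (φ : 𝓞 F →+* ZMod p) : IsDegreeOnePrime p F (RingHom.ker φ) := by
  have hprime : (RingHom.ker φ).IsPrime := RingHom.ker_isPrime φ
  have hpmax : (Ideal.span {(p : ℤ)}).IsMaximal := Int.ideal_span_isMaximal_of_prime p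
  have hmax : (RingHom.ker φ).IsMaximal := RingHom.ker_isMaximal_of_surjective φ
    (ZMod.ringHom_surjective φ)
  have hover : (RingHom.ker φ).LiesOver (Ideal.span {(p : ℤ)}) := by
    constructor
    rw [← intCast_ker (κ := ZMod p)]
    ext x
    simp [Ideal.under, RingHom.mem_ker]
  refine ⟨hprime, hover, ?_⟩
  rw [Ideal.inertiaDeg_eq_of_isMaximal (Ideal.span {(p : ℤ)})]
  let := Ideal.Quotient.field (Ideal.span {(p : ℤ)})
  let := Ideal.Quotient.field (RingHom.ker φ)
  refine finrank_eq_one 1 one_ne_zero fun w ↦ ?_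
  obtain ⟨x, rfl⟩ := Ideal.Quotient.mk_surjective w
  obtain ⟨z, hz⟩ := ZMod.intCast_surjective (φ x)
  refine ⟨Ideal.Quotient.mk _ z, ?_⟩
  rw [Algebra.smul_def, mul_one, Ideal.Quotient.algebraMap_mk_of_liesOver, Ideal.Quotient.eq,
    RingHom.mem_ker, map_sub]
  simp [hz]

theorem IsDegreeOnePrime.exists_ringHom {P : Ideal (𝓞 F)} (hP : IsDegreeOnePrime p F P) :
    ∃ φ : 𝓞 F →+* ZMod p, RingHom.ker φ = P := by
  obtain ⟨hprime, hover, hdeg⟩ := hP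
  have hpmax : (Ideal.span {(p : ℤ)}).IsMaximal := Int.ideal_span_isMaximal_of_prime p
  have hmax : P.IsMaximal := Ideal.IsMaximal.of_liesOver_isMaximal P (Ideal.span {(p : ℤ)})
  rw [Ideal.inertiaDeg_eq_of_isMaximal (Ideal.span {(p : ℤ)})] at hdeg
  let := Ideal.Quotient.field (Ideal.span {(p : ℤ)})
  let := Ideal.Quotient.field P
  have hbij : Function.Bijective (algebraMap (ℤ ⧸ Ideal.span {(p : ℤ)}) (𝓞 F ⧸ P)) := by
    refine ⟨(algebraMap (ℤ ⧸ Ideal.span {(p : ℤ)}) (𝓞 F ⧸ P)).injective, fun w ↦ ?_⟩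
    obtain ⟨c, hc⟩ := (finrank_eq_one_iff_of_nonzero' (1 : 𝓞 F ⧸ P) one_ne_zero).mp hdeg w
    exact ⟨c, by rw [← hc, Algebra.smul_def, mul_one]⟩
  let e : ZMod p ≃+* 𝓞 F ⧸ P :=
    (Int.quotientSpanNatEquivZMod p).symm.trans (RingEquiv.ofBijective _ hbij)
  refine ⟨e.symm.toRingHom.comp (Ideal.Quotient.mk P), ?_⟩
  rw [RingHom.ker_equiv_comp, Ideal.mk_ker]

end DegreeOne

section Tower

variable {ℓ p : ℕ} [Fact ℓ.Prime] [Fact p.Prime] {t : ℤ} {L : Type*} [Field L] [CharZero L]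
  {θ : ℕ → L}

/-- A homomorphism from `𝓞 K_∞` to `𝔽_p` amounts to a backward orbit of `t`. All entries of such an
orbit are periodic by finiteness, and `T_ℓ` is bijective on periodic points. -/
theorem IsCompatible.degreeOne_of_periodic (hθ : IsCompatible ℓ t θ)
    (hirr : ∀ n : ℕ, 1 ≤ n → Irreducible (chebIter ℓ ℤ n - Polynomial.C t))
    (hp : ¬ (p : ℤ) ∣ (ℓ : ℤ) * (4 - t ^ 2))
    (ht : (t : ZMod p) ∈ Function.periodicPts (chebMap ℓ (ZMod p))) :
    (∀ n : ℕ, ∃ P, IsDegreeOnePrime p (level θ n) P) ∧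
      ∃! P, IsDegreeOnePrime p (levelInfty θ) P := by
  obtain ⟨b, hb⟩ := exists_backward_orbit ht
  have hb' : IsCompatible ℓ t b := hb
  refine ⟨fun n ↦ ?_, ?_⟩
  · have h1 := hb'.eval_eq (Nat.zero_le n)
    rw [Nat.sub_zero, hb'.1] at h1
    obtain ⟨φ, -⟩ := hθ.exists_ringHom_level hirr hp n h1
    exact ⟨_, isDegreeOnePrime_ker φ⟩
  · obtain ⟨φ, -⟩ := hθ.exists_ringHom_levelInfty hirr hp hb'
    refine ⟨_, isDegreeOnePrime_ker φ, fun P hP ↦ ?_⟩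
    obtain ⟨ψ, rfl⟩ := hP.exists_ringHom
    have horbit : ∀ χ : 𝓞 (levelInfty θ) →+* ZMod p,
        IsCompatible ℓ t fun n ↦ χ (hθ.intPoint (level_le_levelInfty θ n)) := by
      intro χ
      constructor
      · have h := congrArg χ (hθ.aeval_intPoint_eq_zero (level_le_levelInfty θ 0))
        rw [map_aeval_int, map_zero] at h
        simpa [sub_eq_zero] using h
      · intro n
        have h := congrArg χ (hθ.eval_intPoint n.le_succ (level_le_levelInfty θ n)
          (level_le_levelInfty θ (n + 1)))
        rw [map_aeval_int, Chebyshev.aeval_C] at h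
        simpa [chebMap, chebPoly] using h
    have : ψ = φ := (hθ.isGeneratedPrimeTo_levelInfty hirr Fact.out hp).ringHom_ext fun n ↦
      backward_orbit_unique
        (b := fun n ↦ ψ (hθ.intPoint (level_le_levelInfty θ n)))
        (b' := fun n ↦ φ (hθ.intPoint (level_le_levelInfty θ n))) (horbit ψ).2 (horbit φ).2
        ((horbit ψ).1.trans (horbit φ).1.symm) n
    rw [this]

end Tower

/-! ### The numbers `μ`, `D₁` and `D₂`. -/

section Arithmetic

variable {ℓ p : ℕ} [Fact ℓ.Prime] {hpℓ : p.Coprime ℓ}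

/-- Used when `ρ > 0`: then `ℓ` divides `orderOf α`, hence `p - 1` or `p + 1`. -/
theorem mu_eq_one {e : ℤ} (he : e = 1 ∨ e = -1) (h : (ℓ : ℤ) ∣ p - e) : mu ℓ p hpℓ = 1 := by
  rw [mu, orderOf_eq_one_iff, QuotientGroup.eq_one_iff]
  have h1 : ((p : ℤ) : ZMod ℓ) = (e : ℤ) := by
    rw [← sub_eq_zero, ← Int.cast_sub, ZMod.intCast_zmod_eq_zero_iff_dvd]
    exact h
  rcases he with rfl | rfl
  · have : ZMod.unitOfCoprime p hpℓ = 1 := Units.ext (by simpa using h1)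
    rw [this]
    exact one_mem _
  · have : ZMod.unitOfCoprime p hpℓ = -1 := Units.ext (by simpa using h1)
    rw [this]
    exact Subgroup.mem_zpowers _

variable [Fact p.Prime]

/-- If `μ = 1`, then `D₁` and `D₂` are `p - e` and `p + e` for a sign `e`. -/
theorem D₁_D₂_spec (hμ : mu ℓ p hpℓ = 1) : ∃ e : ℤ, (e = 1 ∨ e = -1) ∧
    (D₁ ℓ p hpℓ : ℤ) = p - e ∧ (D₂ ℓ p hpℓ : ℤ) = p + e ∧
    ∀ j, ℓ ^ j ∣ D₂ ℓ p hpℓ → ℓ ^ j ∣ D₁ ℓ p hpℓ := by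
  have hp1 : 1 ≤ p := (Fact.out : p.Prime).one_le
  have hp2 : 2 ≤ p := (Fact.out : p.Prime).two_le
  have hm : p - 1 ≠ 0 := by omega
  have hp : p + 1 ≠ 0 := by omega
  unfold D₁ D₂
  rw [hμ, pow_one]
  split_ifs with h
  · refine ⟨-1, Or.inr rfl, by push_cast; ring, by push_cast [hp1]; ring, fun j hj ↦ ?_⟩
    rw [padicValNat_dvd_iff_le hm] at hj
    rw [padicValNat_dvd_iff_le hp]
    omega
  · refine ⟨1, Or.inl rfl, by push_cast [hp1]; ring, by push_cast; ring, fun j hj ↦ ?_⟩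
    rw [padicValNat_dvd_iff_le hp] at hj
    rw [padicValNat_dvd_iff_le hm]
    omega

theorem pow_padicValNat_D₁_dvd {v : ℕ} (hv : v = padicValNat ℓ (D₁ ℓ p hpℓ)) {e : ℤ}
    (he : (D₁ ℓ p hpℓ : ℤ) = p - e) (h0 : e = 1 ∨ e = -1) :
    (ℓ : ℤ) ^ v ∣ p - e ∧ ¬ (ℓ : ℤ) ^ (v + 1) ∣ p - e := by
  have hne : D₁ ℓ p hpℓ ≠ 0 := by
    have := (Fact.out : p.Prime).two_le
    intro h
    rw [h] at he
    rcases h0 with rfl | rfl <;> push_cast at he <;> omega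
  rw [← he, hv]
  constructor
  · exact_mod_cast pow_padicValNat_dvd
  · exact_mod_cast pow_succ_padicValNat_not_dvd hne

theorem not_four_dvd_both {a e : ℤ} (he : e = 1 ∨ e = -1) (h1 : (4 : ℤ) ∣ a - e)
    (h2 : (4 : ℤ) ∣ a + e) : False := by
  rcases he with rfl | rfl <;> omega

end Arithmetic

/-! ### Decomposition laws for positive preperiod. -/

section Tower

variable {ℓ p : ℕ} [Fact ℓ.Prime] [Fact p.Prime] {t : ℤ} {L : Type*} [Field L] [CharZero L]
  {θ : ℕ → L} {κ : Type*} [Field κ] [CharP κ p] [IsAlgClosed κ]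

/-- The decomposition law when the point `α` over `t` lies in the group whose order has the larger
valuation. -/
theorem IsCompatible.split_then_inert (hθ : IsCompatible ℓ t θ)
    (hirr : ∀ n : ℕ, 1 ≤ n → Irreducible (chebIter ℓ ℤ n - Polynomial.C t))
    (hp : ¬ (p : ℤ) ∣ (ℓ : ℤ) * (4 - t ^ 2)) {α : κˣ} (hα : (α : κ) + (α : κ)⁻¹ = t)
    {ρ d v : ℕ} (hρ : 0 < ρ) (hord : orderOf α = ℓ ^ ρ * d) (hd : ¬ ℓ ∣ d) {e : ℤ}
    (he : e = 1 ∨ e = -1) (hαe : (orderOf α : ℤ) ∣ p - e) (h3 : 3 ≤ ℓ ^ v)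
    (hv : (ℓ : ℤ) ^ v ∣ p - e) (hv' : ¬ (ℓ : ℤ) ^ (v + 1) ∣ p - e) :
    ρ ≤ v ∧
      (∀ n : ℕ, 1 ≤ n → n ≤ v - ρ → SplitsCompletely p (level θ n)) ∧
      (∀ n : ℕ, v - ρ ≤ n → InertAbove p (level θ (v - ρ)) (level θ n)) := by
  rw [hord] at hαe
  push_cast at hαe
  have hde : (d : ℤ) ∣ p - e := (Dvd.intro_left _ rfl).trans hαe
  have hρv : ρ ≤ v := by
    by_contra hlt
    exact hv' ((pow_dvd_pow _ (by omega)).trans ((Dvd.intro _ rfl).trans hαe))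
  rw [← pow_one (p : ℤ)] at hv hv' hde
  refine ⟨hρv, fun n _ hn ↦ ?_, fun n hn ↦ ?_⟩
  · refine hθ.splitsCompletely (κ := κ) hirr hp fun b hb ↦ ?_
    simpa using frobenius_fixed_of_level hα hρ hord hd he hv hde (by omega) hb
  · refine hθ.inertAbove (κ := κ) (r := 1) hirr hp hn (fun b hb ↦ ?_) fun b hb k hk hkn ↦ ?_
    · exact frobenius_fixed_of_level hα hρ hord hd he hv hde (by omega) hb
    · exact frobenius_ne_of_level hα hρ hord he h3 hv hv' (by omega) hb hk hkn

/-- The decomposition law for `ℓ = 2` when the point `α` over `t` lies in the group whose order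
has the smaller valuation. -/
theorem IsCompatible.inert_then_split_then_inert [Fact (Nat.Prime 2)] (hθ : IsCompatible 2 t θ)
    (hirr : ∀ n : ℕ, 1 ≤ n → Irreducible (chebIter 2 ℤ n - Polynomial.C t))
    (hp : ¬ (p : ℤ) ∣ ((2 : ℕ) : ℤ) * (4 - t ^ 2)) {α : κˣ} (hα : (α : κ) + (α : κ)⁻¹ = t)
    {ρ d v : ℕ} (hρ : 0 < ρ) (hord : orderOf α = 2 ^ ρ * d) (hd : ¬ 2 ∣ d) (hd1 : d ≠ 1) {e : ℤ}
    (he : e = 1 ∨ e = -1) (hαe : (orderOf α : ℤ) ∣ p + e)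
    (hv : (2 : ℤ) ^ v ∣ p - e) (hv' : ¬ (2 : ℤ) ^ (v + 1) ∣ p - e) (h4 : (4 : ℤ) ∣ p - e) :
    ρ ≤ v ∧ Inert p (level θ 1) ∧
      (∀ n : ℕ, 2 ≤ n → n ≤ v - ρ + 1 → SplitsCompletelyAbove p (level θ 1) (level θ n)) ∧
      (∀ n : ℕ, v - ρ + 1 ≤ n → InertAbove p (level θ (v - ρ + 1)) (level θ n)) := by
  rw [hord] at hαe
  push_cast at hαe
  have hde : (d : ℤ) ∣ p + e := (Dvd.intro_left _ rfl).trans hαe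
  have hv2 : 2 ≤ v := by
    by_contra hlt
    exact hv' ((pow_dvd_pow 2 (by omega : v + 1 ≤ 2)).trans (by simpa using h4))
  -- As `4 ∣ p - e`, the number `p + e` is not divisible by `4`.
  have hρ1 : ρ = 1 := by
    by_contra hne
    exact not_four_dvd_both he h4
      (((pow_dvd_pow (2 : ℤ) (by omega : 2 ≤ ρ)).trans (Dvd.intro _ rfl)).trans hαe)
  subst hρ1
  have hfactor : (p : ℤ) ^ 2 - 1 = (p - e) * (p + e) := by
    rcases he with rfl | rfl <;> ring
  have h2pe : (2 : ℤ) ∣ p + e := (Dvd.intro _ (by rw [pow_one])).trans hαe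
  -- Over `𝔽_{p²}` the relevant valuation is that of `p² - 1`, namely `v + 1`: `v` from `p - e` and
  -- one from `p + e`.
  have hw : ((2 : ℕ) : ℤ) ^ (v + 1) ∣ (p : ℤ) ^ 2 - 1 := by
    rw [hfactor, pow_succ]
    exact mul_dvd_mul hv h2pe
  have hw' : ¬ ((2 : ℕ) : ℤ) ^ (v + 1 + 1) ∣ (p : ℤ) ^ 2 - 1 := by
    rw [hfactor]
    intro h
    obtain ⟨x, hx⟩ := hv
    obtain ⟨y, hy⟩ := h2pe
    have hx2 : ¬ (2 : ℤ) ∣ x := fun ⟨z, hz⟩ ↦ hv' ⟨z, by rw [hx, hz]; ring⟩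
    have hy2 : ¬ (2 : ℤ) ∣ y := fun ⟨z, hz⟩ ↦
      not_four_dvd_both he h4 ⟨z, by rw [hy, hz]; ring⟩
    rw [hx, hy, show (2 : ℤ) ^ v * x * (2 * y) = 2 ^ (v + 1) * (x * y) by ring,
      pow_succ _ (v + 1)] at h
    have h' := (mul_dvd_mul_iff_left (pow_ne_zero (v + 1) (two_ne_zero (α := ℤ)))).mp h
    exact (Int.prime_two.dvd_or_dvd h').elim hx2 hy2
  have hdq : (d : ℤ) ∣ (p : ℤ) ^ 2 - 1 := hfactor ▸ hde.mul_left _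
  have h3 : 3 ≤ 2 ^ (v + 1) :=
    le_trans (by norm_num) (Nat.pow_le_pow_right two_pos (by omega : 2 ≤ v + 1))
  have hfix : ∀ n, n + 1 ≤ v + 1 → ∀ b : κ, (Chebyshev.C κ ((2 ^ n : ℕ) : ℤ)).eval b = t →
      b ^ p ^ 2 = b := fun n hn b hb ↦
    frobenius_fixed_of_level hα hρ hord hd (Or.inl rfl) hw hdq hn hb
  -- Here `γ` has order `4 d`. If `b` were in `𝔽_p`, this would divide some `p - δ`; the factor `4`
  -- forces `δ = e`, so `d` divides both `p - e` and `p + e`, hence `2`. As `d` is odd and not `1`,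
  -- this is impossible.
  have hbase : ∀ b : κ, (Chebyshev.C κ ((2 ^ 1 : ℕ) : ℤ)).eval b = t → b ^ p ≠ b := by
    intro b hb hfixb
    obtain ⟨γ, rfl, hγ⟩ := exists_pow_eq_of_chebyshev_eq hα hb
    have hordγ := orderOf_eq_of_pow_eq two_ne_zero hγ
      (hord ▸ Dvd.dvd.mul_right (dvd_pow_self 2 hρ.ne') d)
    rw [hord] at hordγ
    have hfixb' : ((γ : κ) + (γ : κ)⁻¹) ^ p ^ 1 = (γ : κ) + (γ : κ)⁻¹ := by rwa [pow_one]
    obtain ⟨δ, hδ, hdvd⟩ := (frobenius_fixed_iff γ 1).mp hfixb'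
    rw [hordγ, pow_one, pow_one] at hdvd
    push_cast at hdvd
    have h4δ : (4 : ℤ) ∣ p - δ := (Dvd.intro (d : ℤ) (by ring)).trans hdvd
    have hdδ : (d : ℤ) ∣ p - δ := (Dvd.intro_left (4 : ℤ) (by ring)).trans hdvd
    have hδe : δ = e := by
      rcases hδ with rfl | rfl <;> rcases he with rfl | rfl <;> omega
    subst hδe
    have hd2 : (d : ℤ) ∣ 2 := by
      have := dvd_sub hde hdδ
      rcases hδ with rfl | rfl
      · exact (by ring_nf at this; exact this)
      · rw [← dvd_neg]
        exact (by ring_nf at this; exact this)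
    have hd2' : d ∣ 2 := by exact_mod_cast hd2
    rcases (Nat.dvd_prime Nat.prime_two).mp hd2' with h | h
    · exact hd1 h
    · exact hd (h ▸ dvd_rfl)
  refine ⟨by omega, ?_, fun n hn hnv ↦ ?_, fun n hn ↦ ?_⟩
  · refine hθ.inert (κ := κ) hirr hp fun b hb k hk hk2 ↦ ?_
    obtain rfl : k = 1 := by omega
    rw [pow_one]
    exact hbase b hb
  · exact hθ.splitsCompletelyAbove (κ := κ) hirr hp (by omega) hbase (hfix 1 (by omega))
      (hfix n (by omega))
  · refine hθ.inertAbove (κ := κ) (r := 2) hirr hp hn (hfix _ (by omega)) fun b hb k hk hkn ↦ ?_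
    exact frobenius_ne_of_level hα hρ hord (Or.inl rfl) h3 hw hw' (by omega) hb hk hkn

theorem mem_periodicPts_of_preperiod_eq_zero
    (hρ : preperiod (chebMap ℓ (ZMod p)) (t : ZMod p) = 0) :
    (t : ZMod p) ∈ Function.periodicPts (chebMap ℓ (ZMod p)) := by
  obtain ⟨α, d, e, hα, hd, hord, -, -⟩ := exists_unit_add_inv_eq ℓ p t (AlgebraicClosure (ZMod p))
  obtain ⟨s, hs, h⟩ := (exists_iterate_eq_iff_le hα hord hd 0).mpr hρ.le
  exact ⟨s, hs, by simpa [Function.IsPeriodicPt, Function.IsFixedPt] using h⟩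

end Tower

end ChebTower

/-! ### The main theorem: choosing the side on which `α` lies. -/

theorem corollary3p5 (ℓ p : ℕ) [Fact ℓ.Prime] [Fact p.Prime] (hpℓ : p.Coprime ℓ) (t : ℤ)
    (hirr : ∀ n : ℕ, 1 ≤ n → Irreducible (ChebTower.chebIter ℓ ℤ n - Polynomial.C t))
    (hp : ¬ (p : ℤ) ∣ (ℓ : ℤ) * (4 - t ^ 2))
    {L : Type*} [Field L] [CharZero L] (θ : ℕ → L) (hθ : ChebTower.IsCompatible ℓ t θ)
    (v ρ : ℕ) (hv : v = padicValNat ℓ (ChebTower.D₁ ℓ p hpℓ))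
    (hρ : ρ = ChebTower.preperiod (ChebTower.chebMap ℓ (ZMod p)) (t : ZMod p)) :
    -- Case 1: `ℓ` is odd.
    (Odd ℓ →
      (0 < ρ →
        ρ ≤ v ∧
        (∀ n : ℕ, 1 ≤ n → n ≤ v - ρ → ChebTower.SplitsCompletely p (ChebTower.level θ n)) ∧
        (∀ n : ℕ, v - ρ ≤ n →
          ChebTower.InertAbove p (ChebTower.level θ (v - ρ)) (ChebTower.level θ n))) ∧
      (ρ = 0 →
        (∀ n : ℕ, ∃ P, ChebTower.IsDegreeOnePrime p (ChebTower.level θ n) P) ∧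
        (∃! P, ChebTower.IsDegreeOnePrime p (ChebTower.levelInfty θ) P))) ∧
    -- Case 2: `ℓ = 2`.
    (ℓ = 2 →
      (∀ d : ℕ, 0 < ρ → ChebTower.ConnectedToCycle ℓ p (t : ZMod p) d →
        d ∣ ChebTower.D₁ ℓ p hpℓ →
        ρ ≤ v ∧
        (∀ n : ℕ, 1 ≤ n → n ≤ v - ρ → ChebTower.SplitsCompletely p (ChebTower.level θ n)) ∧
        (∀ n : ℕ, v - ρ ≤ n →
          ChebTower.InertAbove p (ChebTower.level θ (v - ρ)) (ChebTower.level θ n))) ∧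
      -- `d = 1` is the fixed point `2`; as `1` divides both numbers, it belongs to `D₁` above.
      (∀ d : ℕ, 0 < ρ → ChebTower.ConnectedToCycle ℓ p (t : ZMod p) d →
        d ∣ ChebTower.D₂ ℓ p hpℓ → d ≠ 1 →
        ρ ≤ v ∧
        ChebTower.Inert p (ChebTower.level θ 1) ∧
        (∀ n : ℕ, 2 ≤ n → n ≤ v - ρ + 1 →
          ChebTower.SplitsCompletelyAbove p (ChebTower.level θ 1) (ChebTower.level θ n)) ∧
        (∀ n : ℕ, v - ρ + 1 ≤ n →
          ChebTower.InertAbove p (ChebTower.level θ (v - ρ + 1)) (ChebTower.level θ n))) ∧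
      (ρ = 0 →
        (∀ n : ℕ, ∃ P, ChebTower.IsDegreeOnePrime p (ChebTower.level θ n) P) ∧
        (∃! P, ChebTower.IsDegreeOnePrime p (ChebTower.levelInfty θ) P))) := by
  have hℓ : ℓ.Prime := Fact.out
  have hpp : p.Prime := Fact.out
  have hzero : ρ = 0 → (∀ n : ℕ, ∃ P, ChebTower.IsDegreeOnePrime p (ChebTower.level θ n) P) ∧
      (∃! P, ChebTower.IsDegreeOnePrime p (ChebTower.levelInfty θ) P) := fun h0 ↦
    hθ.degreeOne_of_periodic hirr hp
      (ChebTower.mem_periodicPts_of_preperiod_eq_zero (hρ ▸ h0))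
  obtain ⟨α, d₀, ε, hα, hd₀, hord, hε, hαε⟩ :=
    ChebTower.exists_unit_add_inv_eq ℓ p t (AlgebraicClosure (ZMod p))
  rw [← hρ] at hord
  have hℓρ : 0 < ρ → (ℓ : ℤ) ∣ p - ε := fun hρ0 ↦
    (Int.natCast_dvd_natCast.mpr (hord ▸ (dvd_pow_self ℓ hρ0.ne').mul_right d₀)).trans hαε
  refine ⟨fun hodd ↦ ⟨fun hρ0 ↦ ?_, hzero⟩, fun h2 ↦ ?_⟩
  · have hμ : ChebTower.mu ℓ p hpℓ = 1 := ChebTower.mu_eq_one hε (hℓρ hρ0)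
    obtain ⟨e, he, hD₁, hD₂, hle⟩ := ChebTower.D₁_D₂_spec hμ
    obtain ⟨hv1, hv2⟩ := ChebTower.pow_padicValNat_D₁_dvd hv hD₁ he
    have hℓ3 : 3 ≤ ℓ := by
      rcases hodd with ⟨k, rfl⟩
      have := hℓ.two_le
      omega
    -- If `e ≠ ε`, then `ℓ` divides `D₂`, hence also `D₁`, whose valuation is at least as large.
    have hℓe : (ℓ : ℤ) ∣ p - e := by
      rcases hε with rfl | rfl <;> rcases he with rfl | rfl
      · exact hℓρ hρ0
      · rw [← hD₁]
        have h := hle 1 (by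
          rw [pow_one, ← Int.natCast_dvd_natCast, hD₂]
          simpa [sub_eq_add_neg] using hℓρ hρ0)
        exact_mod_cast (pow_one ℓ ▸ h)
      · rw [← hD₁]
        have h := hle 1 (by
          rw [pow_one, ← Int.natCast_dvd_natCast, hD₂]
          simpa [sub_eq_add_neg] using hℓρ hρ0)
        exact_mod_cast (pow_one ℓ ▸ h)
      · exact hℓρ hρ0
    -- Opposite signs would make the odd prime `ℓ` divide `2`.
    have heε : e = ε := by
      have h1 := Int.natAbs_dvd_natAbs.mpr (dvd_sub hℓe (hℓρ hρ0))
      rw [Int.natAbs_natCast] at h1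
      rcases hε with rfl | rfl <;> rcases he with rfl | rfl
      · rfl
      · have := Nat.le_of_dvd (by omega) h1
        norm_num at this
        omega
      · have := Nat.le_of_dvd (by omega) h1
        norm_num at this
        omega
      · rfl
    subst heε
    refine hθ.split_then_inert hirr hp hα hρ0 hord hd₀ he hαε ?_ hv1 hv2
    have hv0 : v ≠ 0 := by
      rintro rfl
      exact hv2 (by simpa using hℓe)
    exact hℓ3.trans (Nat.le_self_pow hv0 ℓ)
  · subst h2
    have hp2 : p % 2 = 1 := by
      rcases hpp.eq_two_or_odd with rfl | h
      · norm_num at hpℓ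
      · exact h
    have hμ : ChebTower.mu 2 p hpℓ = 1 :=
      ChebTower.mu_eq_one (Or.inl rfl) (by push_cast; omega)
    obtain ⟨e, he, hD₁, hD₂, hle⟩ := ChebTower.D₁_D₂_spec hμ
    obtain ⟨hv1, hv2⟩ := ChebTower.pow_padicValNat_D₁_dvd hv hD₁ he
    -- One of `p - 1`, `p + 1` is divisible by `4`, and it has the larger valuation.
    have h4 : (4 : ℤ) ∣ p - e := by
      by_contra h4
      have h4' : (4 : ℤ) ∣ p + e := by rcases he with rfl | rfl <;> omega
      have h := hle 2 (by
        rw [← Int.natCast_dvd_natCast, hD₂]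
        exact_mod_cast h4')
      rw [← Int.natCast_dvd_natCast, hD₁] at h
      exact h4 (by exact_mod_cast h)
    have hd₀e : ∀ {x : ℤ}, (d₀ : ℤ) ∣ x + e → (d₀ : ℤ) ∣ x - e → d₀ = 1 := by
      intro x h1 h2
      have h3 : (d₀ : ℤ) ∣ ((2 : ℕ) : ℤ) := by
        obtain ⟨y, hy⟩ := dvd_sub h1 h2
        rcases he with rfl | rfl
        · exact ⟨y, by push_cast; linarith⟩
        · exact ⟨-y, by push_cast; linarith⟩
      rcases (Nat.dvd_prime Nat.prime_two).mp (Int.natCast_dvd_natCast.mp h3) with h | h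
      · exact h
      · exact absurd (h ▸ dvd_rfl) hd₀
    have hd₀α : (d₀ : ℤ) ∣ p - ε :=
      (Int.natCast_dvd_natCast.mpr (hord ▸ Dvd.intro_left _ rfl)).trans hαε
    have hεe : ε = e ∨ ε = -e := by
      rcases he with rfl | rfl <;> rcases hε with rfl | rfl <;> simp
    refine ⟨fun d hρ0 hcon hdD ↦ ?_, fun d hρ0 hcon hdD hd1 ↦ ?_, hzero⟩
    · obtain rfl := ChebTower.eq_of_connectedToCycle hα hord hd₀ hcon
      rw [← Int.natCast_dvd_natCast, hD₁] at hdD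
      have hαe : (orderOf α : ℤ) ∣ p - e := by
        rcases hεe with rfl | rfl
        · exact hαε
        -- On the wrong side `d₀` divides both `p - e` and `p + e`, so `d₀ = 1`; then `4 ∤ p + e`
        -- gives `ρ = 1`. Thus `α` has order `2` and `t² = 4` modulo `p`, which is excluded.
        · exfalso
          rw [sub_neg_eq_add] at hαε hd₀α
          have hd1 := hd₀e hd₀α hdD
          subst hd1
          rw [mul_one] at hord
          have hρ1 : ρ = 1 := by
            by_contra hne
            refine ChebTower.not_four_dvd_both he h4 (dvd_trans ?_ hαε)
            rw [hord]
            exact_mod_cast pow_dvd_pow 2 (by omega : 2 ≤ ρ)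
          rw [hρ1, pow_one] at hord
          have hsq : (α : AlgebraicClosure (ZMod p)) ^ 2 = 1 := by
            have := pow_orderOf_eq_one α
            rw [hord] at this
            rw [← Units.val_pow_eq_pow_val, this, Units.val_one]
          have hinv : (α : AlgebraicClosure (ZMod p))⁻¹ = α :=
            inv_eq_of_mul_eq_one_left (by rw [← sq, hsq])
          rw [hinv] at hα
          refine ChebTower.sq_ne_four_of_not_dvd (κ := AlgebraicClosure (ZMod p)) hp ?_
          rw [← hα]
          linear_combination 4 * hsq
      refine hθ.split_then_inert hirr hp hα hρ0 hord hd₀ he hαe ?_ hv1 hv2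
      have hv2' : 2 ≤ v := by
        by_contra hlt
        exact hv2 ((pow_dvd_pow _ (by omega : v + 1 ≤ 2)).trans (by simpa using h4))
      exact le_trans (by norm_num) (Nat.pow_le_pow_right two_pos hv2')
    · obtain rfl := ChebTower.eq_of_connectedToCycle hα hord hd₀ hcon
      rw [← Int.natCast_dvd_natCast, hD₂] at hdD
      have hαe : (orderOf α : ℤ) ∣ p + e := by
        rcases hεe with rfl | rfl
        · exact absurd (hd₀e hdD hd₀α) hd1
        · rwa [sub_neg_eq_add] at hαε
      exact hθ.inert_then_split_then_inert hirr hp hα hρ0 hord hd₀ hd1 he hαe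
        (by exact_mod_cast hv1) (by exact_mod_cast hv2) h4
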